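/- **Model.** Consider a finite directed graph $\mathcal G(\mathcal V,\mathcal L)$ with nodes $0,\dots,N-1$, $N\ge 1$, where node $0$ is the gateway, and let each link $(i,j)\in\mathcal L$ have a queue with buffer size $B_{ij}\in\{0,1,2,\dots\}\cup\{\infty\}$. Packet $l$ ($l=1,2,\dots$) is generated at an external source at time $s_l$ and arrives at node $0$ at time $a_{l0}\in[0,\infty]$ ($\infty$: it never arrives). The generation and arrival times form arbitrary random processes such that, almost surely, $0\le s_1\le s_2\le\cdots$, $s_l\le a_{l0}$ for all $l$, and only finitely many packets arrive at node $0$ in any bounded time interval (not necessarily in the order of generation). When a node receives a packet for the first time, the packet becomes available at all outgoing links of this node. A link transmits at most one packet at a time; a packet whose transmission over $(i,j)$ is completed is delivered to node $j$ and leaves the link. Each transmission started over link $(i,j)$ has an exponentially distributed duration of rate $\mu_{ij}>0$; the durations are independent across links, i.i.d. across the successive transmissions over a link, and independent of the generation and arrival processes. **Policies.** A causal policy decides at the start, at every arrival at node $0$, at every completed transmission, and at review times which it sets itself, for each link, which available packet (the one in service, one in the queue, or one just received by the origin node) is transmitted from now on, if any, so that preemption and idling are allowed, and which other available packets, at most $B_{ij}$,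 are kept in the queue; the rest is dropped. The decisions are measurable functions of the history up to the current time (location, arrival times and generation times of the packets in the network, and idle/busy states of the links) and possibly of a random seed such that the seed and the generation and arrival processes are jointly independent of the transmission durations. Almost surely, only finitely many decisions are taken in any bounded time interval. $\Pi$ is the set of these policies. A policy in $\Pi$ is a *preemptive LGFS* (Last-Generated, First-Served) policy if at all decision times, each link at which packets are available transmits one with the largest generation time, the packet in service is preempted only by a packet with a strictly larger generation time, and available packets that are not transmitted are stored in the queue unless the queue is full (which packets are dropped in that case is arbitrary). **Age.** Let $a_{lj}$ be the time at which packet $l$ is first received by node $j$ ($\infty$ if never), $s_0=0$, $U_j(t)=\max(\{s_0\}\cup\{s_l: a_{lj}\le t\})$ and $\Delta_j(t)=t-U_j(t)$. Let $\mathbf\Delta_\pi=\{(\Delta_0(t),\dots,\Delta_{N-1}(t)),\,t\in[0,\infty)\}$ be the age process under the policy $\pi$. For vector-valued processes, $\mathbf X\le_{\rm st}\mathbf Y$ means that for all $m$ and $0\le t_1<\dots<t_m$, and every measurable upper set $U$, $\mathbb P\{(\mathbf X(t_1),\dots,\mathbf X(t_m))\in U\}\le\mathbb P\{(\mathbf Y(t_1),\dots,\mathbf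 Y(t_m))\in U\}$. **Corollary.** For every such network, all such packet generation and arrival processes, every preemptive LGFS policy (denoted prmp-LGFS) and every $\pi\in\Pi$, the ages are random variables, and, unconditionally, $$\mathbf\Delta_{\text{prmp-LGFS}}\le_{\rm st}\mathbf\Delta_\pi .$$ -/

import Mathlib

open MeasureTheory ProbabilityTheory
open scoped NNReal ENNReal

namespace AoI

noncomputable section

/-! ### Stochastic orders -/

/-- The usual multivariate stochastic order: `P(X ∈ U) ≤ P(Y ∈ U)` for all (measurable) upper sets
`U` of vectors. -/
def StochLE {Ω Ω' ι : Type*} [MeasurableSpace Ω] [MeasurableSpace Ω'] (μ : Measure Ω)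
    (ν : Measure Ω') (X : Ω → ι → ℝ) (Y : Ω' → ι → ℝ) : Prop :=
  ∀ U : Set (ι → ℝ), IsUpperSet U → MeasurableSet U → μ {ω | X ω ∈ U} ≤ ν {ω | Y ω ∈ U}

/-- The stochastic order of vector-valued processes `(X t) t ∈ [0,∞)`, with coordinates indexed by
`V`: for all `t₁ < ⋯ < tₘ` the random vectors `(X(t₁), …, X(tₘ))` and `(Y(t₁), …, Y(tₘ))`, each
with `m · |V|` real coordinates, are stochastically ordered. -/
def ProcessStochLE {Ω Ω' V : Type*} [MeasurableSpace Ω] [MeasurableSpace Ω'] (μ : Measure Ω)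
    (ν : Measure Ω') (X : ℝ≥0 → Ω → V → ℝ) (Y : ℝ≥0 → Ω' → V → ℝ) : Prop :=
  ∀ (m : ℕ) (t : Fin m → ℝ≥0), StrictMono t →
    StochLE μ ν (fun ω (p : Fin m × V) => X (t p.1) ω p.2) (fun ω p => Y (t p.1) ω p.2)

/-! ### The network -/

/-- A directed graph on the nodes `0, …, n` (node `0` is the gateway) in which every link `e`
carries exponential transmission times of rate `rate e` and has a queue of size `buffer e`
(possibly zero or infinite). -/
structure Network where
  n : ℕ
  links : Finset (Fin (n + 1) × Fin (n + 1))
  rate : links → ℝ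
  rate_pos : ∀ e, 0 < rate e
  buffer : links → ℕ∞

/-- The nodes. -/
abbrev Network.Node (G : Network) : Type := Fin (G.n + 1)

/-- The links. -/
abbrev Network.Link (G : Network) : Type := {e : G.Node × G.Node // e ∈ G.links}

/-- The origin node of a link. -/
def Network.src (G : Network) (e : G.Link) : G.Node := e.1.1

/-- The destination node of a link. -/
def Network.dst (G : Network) (e : G.Link) : G.Node := e.1.2

/-! ### Observations and causal decision rules

Packets are numbered by `ℕ`. The decisions are taken at a sequence of epochs: the start of the
operation, the arrivals of packets at the gateway, the completions of transmissions, and review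
times that the policy sets itself (so that it can preempt or start transmissions at any time). -/

instance instMeasurableSpaceOptionNat : MeasurableSpace (Option ℕ) := ⊤

/-- What can be seen at an epoch, immediately before the decisions of this epoch. Neither the
future arrivals nor the transmission times of uncompleted transmissions are part of it. -/
structure Obs (G : Network) where
  /-- the current time -/
  time : ℝ≥0∞
  /-- the packets received so far by each node -/
  recv : G.Node → Set ℕ
  /-- the packet whose transmission over each link is in progress; `none` if the link is idle,
  in particular if it has just completed a transmission -/
  inService : G.Link → Option ℕ
  /-- the packets that can be sent over or stored at each link: the one in service, those in the
  queue, and those that the origin node has just received -/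
  avail : G.Link → Set ℕ
  /-- the generation times (time stamps) of the packets that are in the network, `0` for others -/
  gen : ℕ → ℝ≥0

instance instMeasurableSpaceObs (G : Network) : MeasurableSpace (Obs G) :=
  MeasurableSpace.comap (fun o => (o.time, o.recv, o.inService, o.avail, o.gen))
    (inferInstance : MeasurableSpace (ℝ≥0∞ × (G.Node → Set ℕ) × (G.Link → Option ℕ) ×
      (G.Link → Set ℕ) × (ℕ → ℝ≥0)))

/-- The observation before the start of the operation; it pads the histories. -/
def Obs.blank (G : Network) : Obs G where
  time := 0
  recv := fun _ => ∅
  inService := fun _ => none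
  avail := fun _ => ∅
  gen := fun _ => 0

/-- A decision rule. The decisions at epoch `k` are functions of a random seed in `R` (for
randomized rules) and of the history `h`, where `h i` is the observation at epoch `i` for `i ≤ k`
and `h i` is blank for `i > k`. -/
structure Policy (G : Network) (R : Type*) [MeasurableSpace R] where
  /-- the packet to be transmitted over each link from now on; `none` for idling -/
  serve : ℕ → R → (ℕ → Obs G) → G.Link → Option ℕ
  /-- the packets to be kept in the queue of each link; all others are dropped -/
  queue : ℕ → R → (ℕ → Obs G) → G.Link → Set ℕ
  /-- the time after which the decisions are reviewed if no arrival or completion occurs before -/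
  timer : ℕ → R → (ℕ → Obs G) → ℝ≥0∞
  measurable_serve : ∀ k, Measurable fun p : R × (ℕ → Obs G) => serve k p.1 p.2
  measurable_queue : ∀ k, Measurable fun p : R × (ℕ → Obs G) => queue k p.1 p.2
  measurable_timer : ∀ k, Measurable fun p : R × (ℕ → Obs G) => timer k p.1 p.2

/-! ### The dynamics -/

/-- The exogenous data of one realization: generation times `gen l`, arrival times `arr l` at the
gateway (`⊤` for a packet that never arrives), the duration `tx e k` of the `k`-th transmission
started over link `e`, and the seed. -/
structure Input (G : Network) (R : Type*) where
  gen : ℕ → ℝ≥0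
  arr : ℕ → ℝ≥0∞
  tx : G.Link → ℕ → ℝ
  seed : R

/-- The state of the system immediately after the decisions of an epoch. -/
structure State (G : Network) where
  /-- the time of the epoch -/
  time : ℝ≥0∞
  /-- the packets received so far by each node -/
  recv : G.Node → Set ℕ
  /-- the packet in transmission over each link -/
  serve : G.Link → Option ℕ
  /-- the packets in the queue of each link -/
  queue : G.Link → Set ℕ
  /-- the time at which the transmission in progress will be completed; `⊤` for an idle link -/
  finish : G.Link → ℝ≥0∞
  /-- the number of transmissions started so far over each link -/
  count : G.Link → ℕ
  /-- the next review time -/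
  review : ℝ≥0∞
  /-- the observations at the past epochs -/
  hist : ℕ → Obs G

/-- The state before the start of the operation; the first epoch is at time `0`. -/
def State.init (G : Network) : State G where
  time := 0
  recv := fun _ => ∅
  serve := fun _ => none
  queue := fun _ => ∅
  finish := fun _ => ⊤
  count := fun _ => 0
  review := 0
  hist := fun _ => Obs.blank G

variable {G : Network} {R : Type*}

/-- The time of the next epoch: the earliest of the next completion of a transmission, the next
arrival at the gateway, and the review time; `⊤` if there is none. -/
def State.nextTime (x : State G) (inp : Input G R) : ℝ≥0∞ :=
  min (⨅ e, x.finish e) (min (⨅ l, ⨅ _ : x.time < inp.arr l, inp.arr l) x.review)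

/-- The link `e` completes its transmission at the next epoch. -/
def State.Completes (x : State G) (inp : Input G R) (e : G.Link) : Prop :=
  x.serve e ≠ none ∧ x.finish e ≤ x.nextTime inp

/-- The packets received by node `j` up to the next epoch: those received before, those delivered
at this epoch over the incoming links, and, for the gateway, those arrived from the source. -/
def State.nextRecv (x : State G) (inp : Input G R) (j : G.Node) : Set ℕ :=
  x.recv j ∪ {l | ∃ e, G.dst e = j ∧ x.Completes inp e ∧ x.serve e = some l} ∪
    {l | j = 0 ∧ inp.arr l ≤ x.nextTime inp}

open Classical in
/-- The observation at the next epoch. A packet becomes available at the outgoing links of a node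
when this node receives the packet for the first time. -/
def State.nextObs (x : State G) (inp : Input G R) : Obs G where
  time := x.nextTime inp
  recv := x.nextRecv inp
  inService := fun e => if x.Completes inp e then none else x.serve e
  avail := fun e => x.queue e ∪ {l | ¬ x.Completes inp e ∧ x.serve e = some l} ∪
    (x.nextRecv inp (G.src e) \ x.recv (G.src e))
  gen := fun l => if l ∈ x.nextRecv inp 0 then inp.gen l else 0

variable [MeasurableSpace R]

/-- The history on which the decisions of epoch `k`, the one that follows the state `x`, are
based. -/
def State.nextHist (x : State G) (inp : Input G R) (k : ℕ) : ℕ → Obs G :=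
  Function.update x.hist k (x.nextObs inp)

/-- The packet in transmission over link `e` after epoch `k`. -/
def State.nextServe (π : Policy G R) (x : State G) (inp : Input G R) (k : ℕ) (e : G.Link) :
    Option ℕ :=
  π.serve k inp.seed (x.nextHist inp k) e

/-- The packets in the queue of link `e` after epoch `k`. -/
def State.nextQueue (π : Policy G R) (x : State G) (inp : Input G R) (k : ℕ) (e : G.Link) :
    Set ℕ :=
  π.queue k inp.seed (x.nextHist inp k) e

open Classical in
/-- The state after epoch `k`. A transmission that is neither completed nor preempted goes on; any
other transmission is a new one, and takes the next transmission time of its link. -/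
def State.next (π : Policy G R) (inp : Input G R) (k : ℕ) (x : State G) : State G where
  time := x.nextTime inp
  recv := x.nextRecv inp
  serve := x.nextServe π inp k
  queue := x.nextQueue π inp k
  finish := fun e =>
    if x.nextServe π inp k e = none then ⊤
    else if x.nextServe π inp k e = (x.nextObs inp).inService e then x.finish e
    else x.nextTime inp + ENNReal.ofReal (inp.tx e (x.count e))
  count := fun e =>
    if x.nextServe π inp k e = none ∨ x.nextServe π inp k e = (x.nextObs inp).inService e then
      x.count e
    else x.count e + 1
  review := x.nextTime inp + π.timer k inp.seed (x.nextHist inp k)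
  hist := x.nextHist inp k

/-- The run of the system under a decision rule: `run k` is the state before epoch `k`, that is,
after the epochs `0, …, k - 1`. -/
def run (π : Policy G R) (inp : Input G R) : ℕ → State G
  | 0 => State.init G
  | k + 1 => (run π inp k).next π inp k

/-! ### Ages -/

/-- The time `a_{lj}` at which packet `l` is received by node `j`; `⊤` if it never is. -/
def deliveryTime (π : Policy G R) (inp : Input G R) (l : ℕ) (j : G.Node) : ℝ≥0∞ :=
  ⨅ k, ⨅ _ : l ∈ (run π inp k).recv j, (run π inp k).time

/-- The generation time of the freshest packet received by node `j` up to time `t`, and `0` if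
there is none. -/
def freshest (π : Policy G R) (inp : Input G R) (j : G.Node) (t : ℝ≥0) : ℝ≥0 :=
  sSup (insert 0 {s | ∃ l, deliveryTime π inp l j ≤ t ∧ s = inp.gen l})

/-- The age `Δ_j(t)` at node `j`. -/
def age (π : Policy G R) (inp : Input G R) (t : ℝ≥0) (j : G.Node) : ℝ :=
  (t : ℝ) - (freshest π inp j t : ℝ)

/-! ### Policies -/

/-- Along the realization `inp`, the decisions of `π` obey the rules of the system: a link sends an
available packet, its queue holds other available packets, at most as many as the buffer allows;
and only finitely many decisions are taken in a bounded time. -/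
def Policy.Admissible (π : Policy G R) (inp : Input G R) : Prop :=
  (∀ k, (run π inp k).nextTime inp < ⊤ → ∀ e : G.Link,
    (∀ l, (run π inp k).nextServe π inp k e = some l →
      l ∈ ((run π inp k).nextObs inp).avail e ∧ l ∉ (run π inp k).nextQueue π inp k e) ∧
    (run π inp k).nextQueue π inp k e ⊆ ((run π inp k).nextObs inp).avail e ∧
    ((run π inp k).nextQueue π inp k e).encard ≤ G.buffer e) ∧
  ∀ t : ℝ≥0, ∃ k, (t : ℝ≥0∞) < (run π inp k).time

/-- Along the realization `inp`, the policy `π` follows the preemptive Last-Generated, First-Served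
discipline: at any epoch and for any link,
* if packets are available, then the link sends one with the largest generation time;
* the packet in service is preempted only by a packet with a strictly larger generation time;
* the available packets that are not sent are stored in the queue, unless the queue is full (which
packets are then dropped is left open). -/
def Policy.IsPreemptiveLGFS (π : Policy G R) (inp : Input G R) : Prop :=
  ∀ k, (run π inp k).nextTime inp < ⊤ → ∀ e : G.Link,
    ((((run π inp k).nextObs inp).avail e).Nonempty →
      ∃ l, (run π inp k).nextServe π inp k e = some l ∧
        ∀ l' ∈ ((run π inp k).nextObs inp).avail e, inp.gen l' ≤ inp.gen l) ∧
    (∀ l, ((run π inp k).nextObs inp).inService e = some l →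
      (∀ l' ∈ ((run π inp k).nextObs inp).avail e, inp.gen l' ≤ inp.gen l) →
        (run π inp k).nextServe π inp k e = some l) ∧
    ((∀ l ∈ ((run π inp k).nextObs inp).avail e,
        (run π inp k).nextServe π inp k e = some l ∨ l ∈ (run π inp k).nextQueue π inp k e) ∨
      ((run π inp k).nextQueue π inp k e).encard = G.buffer e)

end

end AoI

/-! The two systems are compared on common clocks. Suppose every link carries one exponential clock
and, while busy, completes its transmission when that clock rings, whichever policy is in force. If
the LGFS system is ahead, in the sense that each node holds a packet at least as fresh as any packet
this node holds in the other system, then it stays ahead: when the other system delivers over a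
link, the LGFS link either rings at the same moment with a freshest packet of its origin in service,
or its destination already holds a packet that fresh. This is
`State.Dominates.exists_le_of_mem_nextRecv`; the invariant `State.Greedy` behind it is preserved by
`State.Greedy.next`.

The actual model has no common clocks: transmissions start at different times under the two policies
and have their own durations. Memorylessness bridges the gap. At an epoch, the residual times of the
transmissions that go on can be redrawn without changing the law of the future
(`Memoryless.renewal`). Hence the actual run has the same expected value as a fictitious one in
which all residual times are redrawn at every epoch (`lintegral_runValue`), and the fictitious run
may also be redrawn at the epochs of another system (`freshValue_advance`). So both fictitious runs
can be restarted at their merged epochs with the same clock vector. No joint probability space is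
built: the recursively defined expected values are compared under one integral sign, by induction on
the number of epochs (`freshValue_le_freshValue`).

The value of a run is the indicator that the ages at the chosen times lie in an upper set. Runs are
truncated after `n` epochs; a run cut off too early counts 0 for the LGFS policy and 1 for its
competitor, so the inequality holds for each `n`. Since almost surely finitely many epochs precede
the horizon, the probabilities are recovered as `n` tends to infinity
(`tendsto_lintegral_runValue`). Generation times, arrival times and seed stay fixed during the
comparison and are integrated out at the end, which their independence of the transmission times
permits (`lintegral_runValue_eq`). -/

namespace AoI

/-! ### Memoryless clocks -/

/-- The memoryless property of the law of a waiting time: given that it exceeds `s`, the residual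
waiting time has the original law. -/
def Memoryless (η : Measure ℝ≥0∞) : Prop :=
  ∀ (s : ℝ≥0∞) (B : Set ℝ≥0∞), MeasurableSet B →
    η (B ∩ Set.Ioi s) = η (Set.Ioi s) * η ((fun x => s + x) ⁻¹' B)

/-- The maximum with 0 covers negative levels, which occur in the next lemma when a half-line is
translated. -/
lemma expMeasure_Ioi {r : ℝ} (hr : 0 < r) (x : ℝ) :
    expMeasure r (Set.Ioi x) = ENNReal.ofReal (Real.exp (-(r * max x 0))) := by
  have := isProbabilityMeasure_expMeasure hr
  have h1 : (expMeasure r).real (Set.Iic x) = 1 - Real.exp (-(r * max x 0)) := by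
    rw [← cdf_eq_real, cdf_expMeasure_eq hr]
    split_ifs with h
    · rw [max_eq_left h]
    · rw [max_eq_right (not_le.1 h).le]; simp
  have h2 : (expMeasure r).real (Set.Ioi x) = Real.exp (-(r * max x 0)) := by
    rw [← Set.compl_Iic, probReal_compl_eq_one_sub measurableSet_Iic, h1]; ring
  rw [← h2, ofReal_measureReal]

/-- Exponential tails are multiplicative, which gives equality on half-lines; these form a
generating π-system. As an identity of measures the property is available for all Borel sets, not
only for tails. -/
lemma expMeasure_restrict_Ioi {r : ℝ} (hr : 0 < r) {a : ℝ} (ha : 0 ≤ a) :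
    (expMeasure r).restrict (Set.Ioi a) =
      expMeasure r (Set.Ioi a) • (expMeasure r).map (fun x => a + x) := by
  have := isProbabilityMeasure_expMeasure hr
  have : IsProbabilityMeasure ((expMeasure r).map (fun x => a + x)) :=
    Measure.isProbabilityMeasure_map (by fun_prop)
  have hIoi : ∀ b, (expMeasure r).restrict (Set.Ioi a) (Set.Ioi b) =
      (expMeasure r (Set.Ioi a) • (expMeasure r).map (fun x => a + x)) (Set.Ioi b) := by
    intro b
    rw [Measure.restrict_apply measurableSet_Ioi, Set.Ioi_inter_Ioi, Measure.smul_apply,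
      Measure.map_apply (by fun_prop) measurableSet_Ioi]
    have : (fun x => a + x) ⁻¹' Set.Ioi b = Set.Ioi (b - a) := by
      ext x; simp [sub_lt_iff_lt_add']
    rw [this, smul_eq_mul, expMeasure_Ioi hr, expMeasure_Ioi hr, expMeasure_Ioi hr,
      ← ENNReal.ofReal_mul (Real.exp_pos _).le, ← Real.exp_add]
    congr 3
    rcases le_total b a with h | h
    · rw [sup_eq_right.2 h, max_eq_right (sub_nonpos.2 h)]; ring
    · rw [sup_eq_left.2 h, max_eq_left (sub_nonneg.2 h), max_eq_left ha, max_eq_left (ha.trans h)]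
      ring
  refine ext_of_generate_finite _ (borel_eq_generateFrom_Ioi ℝ ▸ BorelSpace.measurable_eq)
    isPiSystem_Ioi ?_ ?_
  · rintro _ ⟨b, rfl⟩
    exact hIoi b
  · simp

lemma expMeasure_ae_pos {r : ℝ} (hr : 0 < r) : ∀ᵐ x ∂expMeasure r, 0 < x := by
  have := isProbabilityMeasure_expMeasure hr
  have : expMeasure r (Set.Ioi 0) = 1 := by rw [expMeasure_Ioi hr]; simp
  exact (prob_compl_eq_zero_iff measurableSet_Ioi).2 this

/-- The law of an exponential transmission time, as an extended nonnegative number. -/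
noncomputable def expClock (r : ℝ) : Measure ℝ≥0∞ := (expMeasure r).map ENNReal.ofReal

lemma isProbabilityMeasure_expClock {r : ℝ} (hr : 0 < r) : IsProbabilityMeasure (expClock r) :=
  have := isProbabilityMeasure_expMeasure hr
  Measure.isProbabilityMeasure_map (by fun_prop)

lemma expClock_ae_pos {r : ℝ} (hr : 0 < r) : ∀ᵐ x ∂expClock r, 0 < x := by
  rw [expClock, ae_map_iff (by fun_prop) measurableSet_Ioi]
  filter_upwards [expMeasure_ae_pos hr] with x hx
  simpa using hx

lemma memoryless_expClock {r : ℝ} (hr : 0 < r) : Memoryless (expClock r) := by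
  intro s B hB
  have hm : Measurable ENNReal.ofReal := by fun_prop
  induction s with
  | top => simp
  | coe a =>
    have hpre : ENNReal.ofReal ⁻¹' Set.Ioi (a : ℝ≥0∞) = Set.Ioi (a : ℝ) := by
      ext x
      simp only [Set.mem_preimage, Set.mem_Ioi]
      rw [← ENNReal.ofReal_coe_nnreal, ENNReal.ofReal_lt_ofReal_iff']
      exact ⟨fun h => h.1, fun h => ⟨h, lt_of_le_of_lt a.coe_nonneg h⟩⟩
    rw [expClock, Measure.map_apply hm (hB.inter measurableSet_Ioi),
      Measure.map_apply hm measurableSet_Ioi,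
      Measure.map_apply hm (measurable_const_add _ hB), Set.preimage_inter, hpre,
      ← Measure.restrict_apply (hm hB), expMeasure_restrict_Ioi hr a.coe_nonneg, Measure.smul_apply,
      smul_eq_mul, Measure.map_apply (by fun_prop) (hm hB)]
    congr 1
    -- `ENNReal.ofReal` is additive on nonnegative reals only, so the two events agree up to the
    -- null set of nonpositive durations.
    refine measure_congr ?_
    filter_upwards [expMeasure_ae_pos hr] with x hx
    refine propext ?_
    change ENNReal.ofReal (a + x) ∈ B ↔ a + ENNReal.ofReal x ∈ B
    rw [ENNReal.ofReal_add a.coe_nonneg hx.le, ENNReal.ofReal_coe_nnreal]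

/-! ### Resampling the coordinates of product measures -/

open Classical in
/-- Replacing some of the coordinates of a random vector with independent components by
independent copies does not change its law. -/
lemma map_ite_infinitePi {ι : Type*} {X : ι → Type*} [∀ i, MeasurableSpace (X i)]
    (κ : ∀ i, Measure (X i)) [∀ i, IsProbabilityMeasure (κ i)] (p : ι → Prop) :
    ((Measure.infinitePi κ).prod (Measure.infinitePi κ)).map
      (fun z i => if p i then z.1 i else z.2 i) = Measure.infinitePi κ := by
  have hm : Measurable fun (z : (∀ i, X i) × (∀ i, X i)) i => if p i then z.1 i else z.2 i := by
    refine measurable_pi_lambda _ fun i => ?_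
    split_ifs <;> fun_prop
  refine Measure.eq_infinitePi κ fun s t ht => ?_
  rw [Measure.map_apply hm (MeasurableSet.pi s.countable_toSet fun i _ => ht i)]
  have : (fun (z : (∀ i, X i) × (∀ i, X i)) i => if p i then z.1 i else z.2 i) ⁻¹'
      Set.pi s t = Set.pi (s.filter p) t ×ˢ Set.pi (s.filter fun i => ¬ p i) t := by
    ext z
    simp only [Set.mem_preimage, Set.mem_pi, Set.mem_prod, Finset.coe_filter, Set.mem_ofPred_eq,
      Finset.mem_coe]
    constructor
    · intro h
      exact ⟨fun i hi => by simpa [hi.2] using h i hi.1, fun i hi => by simpa [hi.2] using h i hi.1⟩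
    · rintro ⟨h1, h2⟩ i hi
      split_ifs with hp
      · exact h1 i ⟨hi, hp⟩
      · exact h2 i ⟨hi, hp⟩
  rw [this, Measure.prod_prod, Measure.infinitePi_pi _ fun i _ => ht i,
    Measure.infinitePi_pi _ fun i _ => ht i, Finset.prod_filter_mul_prod_filter_not]

open Classical in
lemma lintegral_infinitePi_resample {ι : Type*} {X : ι → Type*} [∀ i, MeasurableSpace (X i)]
    (κ : ∀ i, Measure (X i)) [∀ i, IsProbabilityMeasure (κ i)] (p : ι → Prop)
    {F : (∀ i, X i) → ℝ≥0∞} (hF : Measurable F) :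
    ∫⁻ r, F r ∂Measure.infinitePi κ =
      ∫⁻ r', ∫⁻ r, F (fun i => if p i then r' i else r i) ∂Measure.infinitePi κ
        ∂Measure.infinitePi κ := by
  have hm : Measurable fun (z : (∀ i, X i) × (∀ i, X i)) i => if p i then z.1 i else z.2 i := by
    refine measurable_pi_lambda _ fun i => ?_
    split_ifs <;> fun_prop
  conv_lhs => rw [← map_ite_infinitePi κ p]
  rw [lintegral_map hF hm]
  exact lintegral_prod _ (hF.comp hm).aemeasurable

section Clocks

open Classical

variable {ι : Type*} [Fintype ι] {η : ι → Measure ℝ≥0∞} [∀ i, IsProbabilityMeasure (η i)]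

/-- Here the redrawn vector is integrated inside, so that the inner integral is taken with the
coordinates outside `p` frozen. -/
lemma lintegral_pi_resample (p : ι → Prop) {F : (ι → ℝ≥0∞) → ℝ≥0∞} (hF : Measurable F) :
    ∫⁻ r, F r ∂Measure.pi η =
      ∫⁻ r, ∫⁻ r', F (fun i => if p i then r' i else r i) ∂Measure.pi η ∂Measure.pi η := by
  have hm : Measurable fun z : (ι → ℝ≥0∞) × (ι → ℝ≥0∞) =>
      F (fun i => if p i then z.2 i else z.1 i) := by
    refine hF.comp (measurable_pi_lambda _ fun i => ?_)
    split_ifs <;> fun_prop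
  rw [lintegral_lintegral_swap hm.aemeasurable]
  simpa only [Measure.infinitePi_eq_pi] using lintegral_infinitePi_resample η p hF

/-- The conditioning event is a box, so restriction acts coordinate by coordinate and memorylessness
is applied to each factor; boxes determine the measure. -/
lemma Memoryless.restrict_pi (h : ∀ i, Memoryless (η i)) (p : ι → Prop) (s : ℝ≥0∞) :
    (Measure.pi η).restrict {r | ∀ i, p i → s < r i} =
      Measure.pi η {r | ∀ i, p i → s < r i} •
        (Measure.pi η).map (fun r i => if p i then s + r i else r i) := by
  have hset : {r : ι → ℝ≥0∞ | ∀ i, p i → s < r i} =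
      Set.pi Set.univ fun i => if p i then Set.Ioi s else Set.univ := by
    ext r
    simp only [Set.mem_ofPred_eq, Set.mem_pi, Set.mem_univ, true_imp_iff]
    refine forall_congr' fun i => ?_
    split_ifs with hp <;> simp [hp]
  have hm : Measurable fun (r : ι → ℝ≥0∞) i => if p i then s + r i else r i := by
    refine measurable_pi_lambda _ fun i => ?_
    split_ifs <;> fun_prop
  rw [hset, Measure.restrict_pi_pi]
  refine Measure.pi_eq fun B hB => ?_
  rw [Measure.smul_apply, smul_eq_mul, Measure.map_apply hm (.univ_pi hB), Measure.pi_pi]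
  have : (fun (r : ι → ℝ≥0∞) i => if p i then s + r i else r i) ⁻¹' Set.pi Set.univ B =
      Set.pi Set.univ fun i => if p i then (fun x => s + x) ⁻¹' B i else B i := by
    ext r
    simp only [Set.mem_preimage, Set.mem_pi, Set.mem_univ, true_imp_iff]
    refine forall_congr' fun i => ?_
    split_ifs with hp <;> simp
  rw [this, Measure.pi_pi, ← Finset.prod_mul_distrib]
  refine Finset.prod_congr rfl fun i _ => ?_
  rw [Measure.restrict_apply (hB i)]
  split_ifs with hp
  · exact (h i s (B i) (hB i)).symm
  · simp

lemma Memoryless.lintegral_const (h : ∀ i, Memoryless (η i)) (p : ι → Prop) (s : ℝ≥0∞)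
    {F : (ι → ℝ≥0∞) → ℝ≥0∞} (hF : Measurable F) :
    ∫⁻ r, (if ∀ i, p i → s < r i then F r else 0) ∂Measure.pi η =
      ∫⁻ r, (if ∀ i, p i → s < r i then
        ∫⁻ r', F (fun i => if p i then s + r' i else r' i) ∂Measure.pi η else 0)
        ∂Measure.pi η := by
  have hset : MeasurableSet {r : ι → ℝ≥0∞ | ∀ i, p i → s < r i} := by
    simp only [Set.ofPred_forall]
    exact .iInter fun i => .iInter fun _ => measurableSet_lt measurable_const (measurable_pi_apply i)
  have hm : Measurable fun (r : ι → ℝ≥0∞) i => if p i then s + r i else r i := by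
    refine measurable_pi_lambda _ fun i => ?_
    split_ifs <;> fun_prop
  have key : ∀ K : (ι → ℝ≥0∞) → ℝ≥0∞,
      ∫⁻ r, (if ∀ i, p i → s < r i then K r else 0) ∂Measure.pi η =
        ∫⁻ r in {r | ∀ i, p i → s < r i}, K r ∂Measure.pi η := by
    intro K
    rw [← lintegral_indicator hset]
    simp only [Set.indicator_apply, Set.mem_ofPred_eq]
  rw [key, key, Memoryless.restrict_pi h, lintegral_smul_measure, lintegral_smul_measure,
    lintegral_map hF hm, MeasureTheory.lintegral_const, Measure.map_apply hm .univ]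
  simp

/-- Given that the clocks in `p` exceed a level that depends on the other clocks only, their
excesses can be replaced by independent copies of the clocks. -/
lemma Memoryless.lintegral (h : ∀ i, Memoryless (η i)) (p : ι → Prop)
    {s : (ι → ℝ≥0∞) → ℝ≥0∞} (hs : Measurable s)
    (hsp : ∀ r r', (∀ i, ¬ p i → r i = r' i) → s r = s r')
    {F : (ι → ℝ≥0∞) → ℝ≥0∞} (hF : Measurable F) :
    ∫⁻ r, (if ∀ i, p i → s r < r i then F r else 0) ∂Measure.pi η =
      ∫⁻ r, (if ∀ i, p i → s r < r i then
        ∫⁻ r', F (fun i => if p i then s r + r' i else r i) ∂Measure.pi η else 0)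
        ∂Measure.pi η := by
  have hset : MeasurableSet {r : ι → ℝ≥0∞ | ∀ i, p i → s r < r i} := by
    simp only [Set.ofPred_forall]
    exact .iInter fun i => .iInter fun _ => measurableSet_lt hs (measurable_pi_apply i)
  have hsr : ∀ r r' : ι → ℝ≥0∞, s (fun i => if p i then r' i else r i) = s r := fun r r' =>
    hsp _ _ fun i hi => by simp [hi]
  have hm1 : Measurable fun z : (ι → ℝ≥0∞) × (ι → ℝ≥0∞) =>
      F (fun i => if p i then s z.1 + z.2 i else z.1 i) := by
    refine hF.comp (measurable_pi_lambda _ fun i => ?_)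
    split_ifs <;> fun_prop
  -- Redrawing the clocks in `p` first freezes the other clocks and, by `hsp`, the level `s r`; the
  -- inner integral then has a constant level.
  rw [lintegral_pi_resample p (Measurable.ite hset hF measurable_const),
    lintegral_pi_resample p (Measurable.ite hset hm1.lintegral_prod_right' measurable_const)]
  refine lintegral_congr fun r => ?_
  simp only [hsr]
  have hm2 : Measurable fun r' : ι → ℝ≥0∞ => F (fun i => if p i then r' i else r i) := by
    refine hF.comp (measurable_pi_lambda _ fun i => ?_)
    split_ifs <;> fun_prop
  have := Memoryless.lintegral_const h p (s r) hm2
  have e : ∀ r' : ι → ℝ≥0∞, (∀ i, p i → s r < if p i then r' i else r i) ↔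
      ∀ i, p i → s r < r' i := fun r' => forall_congr' fun i => by
    by_cases hp : p i <;> simp [hp]
  simp only [e]
  rw [this]
  refine lintegral_congr fun r' => ?_
  congr 2
  funext r''
  congr 1
  funext i
  by_cases hp : p i <;> simp [hp]

end Clocks

/-! ### Renewal at the first tick of a set of clocks -/

section Renewal

open Classical

variable {ι : Type*}

/-- The first time at which one of the clocks in `D`, started at time `t`, rings, or `c` if no clock
rings before `c`. -/
noncomputable def firstRing (D : ι → Prop) (t c : ℝ≥0∞) (r : ι → ℝ≥0∞) : ℝ≥0∞ :=
  min (⨅ i, if D i then t + r i else ⊤) c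

variable {D : ι → Prop} {t c : ℝ≥0∞}

lemma firstRing_le (r : ι → ℝ≥0∞) : firstRing D t c r ≤ c := min_le_right _ _

lemma firstRing_le_of_mem {i : ι} (r : ι → ℝ≥0∞) (hi : D i) : firstRing D t c r ≤ t + r i :=
  (min_le_left _ _).trans ((iInf_le _ i).trans (by simp [hi]))

lemma le_firstRing (htc : t ≤ c) (r : ι → ℝ≥0∞) : t ≤ firstRing D t c r := by
  refine le_min (le_iInf fun i => ?_) htc
  split_ifs
  · exact le_self_add
  · exact le_top

lemma le_firstRing_iff {a : ℝ≥0∞} {r : ι → ℝ≥0∞} :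
    a ≤ firstRing D t c r ↔ (∀ i, D i → a ≤ t + r i) ∧ a ≤ c := by
  rw [firstRing, le_min_iff, le_iInf_iff]
  refine and_congr_left fun _ => forall_congr' fun i => ?_
  split_ifs with h <;> simp [h]

lemma firstRing_congr {r r' : ι → ℝ≥0∞} (h : ∀ i, D i → r i = r' i) :
    firstRing D t c r = firstRing D t c r' := by
  unfold firstRing
  congr 2
  funext i
  split_ifs with hi
  · rw [h i hi]
  · rfl

variable [Fintype ι]

lemma firstRing_eq_or (r : ι → ℝ≥0∞) :
    firstRing D t c r = c ∨ ∃ i, D i ∧ firstRing D t c r = t + r i := by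
  rcases isEmpty_or_nonempty ι with hι | hι
  · left; simp [firstRing]
  · obtain ⟨i, hi⟩ := exists_eq_ciInf_of_finite (f := fun i => if D i then t + r i else (⊤ : ℝ≥0∞))
    by_cases hD : D i
    · simp only [hD, if_true] at hi
      rcases le_total c (t + r i) with h | h
      · left; rw [firstRing, ← hi, min_eq_right h]
      · right; exact ⟨i, hD, by rw [firstRing, ← hi, min_eq_left h]⟩
    · left
      simp only [hD, if_false] at hi
      rw [firstRing, ← hi]; simp

lemma measurable_firstRing : Measurable (firstRing D t c) := by
  refine Measurable.min (.iInf fun i => ?_) measurable_const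
  split_ifs <;> fun_prop

/-- The clocks that ring first. -/
noncomputable def ringing (D : ι → Prop) (t c : ℝ≥0∞) (r : ι → ℝ≥0∞) : Finset ι :=
  Finset.univ.filter fun i => D i ∧ t + r i ≤ firstRing D t c r

lemma mem_ringing {r : ι → ℝ≥0∞} {i : ι} :
    i ∈ ringing D t c r ↔ D i ∧ t + r i ≤ firstRing D t c r := by simp [ringing]

/-- The event that exactly `C` rings first is split into a condition on the clocks in `C` alone and
the condition that the other clocks of `D` exceed a level computed from `C`. This is the shape that
`Memoryless.lintegral` requires. -/
lemma ringing_eq_iff (htc : t ≤ c) (ht : t ≠ ⊤) (C : Finset ι) (r : ι → ℝ≥0∞) :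
    ringing D t c r = C ↔
      (∀ i, (D i ∧ i ∉ C) → firstRing (· ∈ C) t c r - t < r i) ∧
        ∀ i ∈ C, D i ∧ t + r i ≤ firstRing (· ∈ C) t c r := by
  have hlt : ∀ i, firstRing (· ∈ C) t c r - t < r i ↔ firstRing (· ∈ C) t c r < t + r i := by
    intro i
    conv_rhs => rw [← add_tsub_cancel_of_le (le_firstRing (D := (· ∈ C)) htc r)]
    exact (ENNReal.add_lt_add_iff_left ht).symm
  simp only [hlt]
  constructor
  · intro h
    have hM : firstRing D t c r = firstRing (· ∈ C) t c r := by
      refine le_antisymm (le_firstRing_iff.2 ⟨fun i hi => ?_, firstRing_le r⟩) ?_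
      · exact firstRing_le_of_mem r (mem_ringing.1 (h ▸ hi)).1
      · rcases firstRing_eq_or (D := D) (t := t) (c := c) r with h' | ⟨i, hi, h'⟩
        · rw [h']; exact firstRing_le r
        · have : i ∈ C := h ▸ mem_ringing.2 ⟨hi, h'.ge⟩
          rw [h']; exact firstRing_le_of_mem (D := (· ∈ C)) r this
    refine ⟨fun i hi => not_le.1 fun hle => hi.2 (h ▸ mem_ringing.2 ⟨hi.1, hM ▸ hle⟩),
      fun i hi => ?_⟩
    rw [← hM]
    exact mem_ringing.1 (h ▸ hi)
  · rintro ⟨h1, h2⟩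
    have hM : firstRing D t c r = firstRing (· ∈ C) t c r := by
      refine le_antisymm (le_firstRing_iff.2 ⟨fun i hi => ?_, firstRing_le r⟩)
        (le_firstRing_iff.2 ⟨fun i hi => ?_, firstRing_le r⟩)
      · exact firstRing_le_of_mem r (h2 i hi).1
      · by_cases hC : i ∈ C
        · exact firstRing_le_of_mem (D := (· ∈ C)) r hC
        · exact (h1 i ⟨hi, hC⟩).le
    ext i
    rw [mem_ringing, hM]
    constructor
    · rintro ⟨hD, hle⟩
      by_contra hC
      exact absurd (h1 i ⟨hD, hC⟩) (not_lt.2 hle)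
    · exact h2 i

lemma firstRing_eq_of_ringing_eq {C : Finset ι} {r : ι → ℝ≥0∞} (h : ringing D t c r = C) :
    firstRing D t c r = firstRing (· ∈ C) t c r := by
  refine le_antisymm (le_firstRing_iff.2 ⟨fun i hi => ?_, firstRing_le r⟩) ?_
  · exact firstRing_le_of_mem r (mem_ringing.1 (h ▸ hi)).1
  · rcases firstRing_eq_or (D := D) (t := t) (c := c) r with h' | ⟨i, hi, h'⟩
    · rw [h']; exact firstRing_le r
    · have : i ∈ C := h ▸ mem_ringing.2 ⟨hi, h'.ge⟩
      rw [h']; exact firstRing_le_of_mem (D := (· ∈ C)) r this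

lemma measurable_ite_ringing {β : Type*} [MeasurableSpace β] (C : Finset ι)
    {f g : (ι → ℝ≥0∞) → β} (hf : Measurable f) (hg : Measurable g) :
    Measurable fun r => if ringing D t c r = C then f r else g r := by
  refine Measurable.ite ?_ hf hg
  have : {r | ringing D t c r = C} = {r | ∀ i, (D i ∧ t + r i ≤ firstRing D t c r) ↔ i ∈ C} := by
    ext r
    simp only [Set.mem_ofPred_eq, Finset.ext_iff, mem_ringing]
  rw [this, Set.ofPred_forall]
  refine .iInter fun i => ?_
  have hm : MeasurableSet {r : ι → ℝ≥0∞ | D i ∧ t + r i ≤ firstRing D t c r} := by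
    refine (MeasurableSet.const _).inter (measurableSet_le ?_ measurable_firstRing)
    fun_prop
  by_cases hi : i ∈ C
  · simpa [hi] using hm
  · simpa only [hi, iff_false, Set.compl_ofPred] using hm.compl

lemma lintegral_eq_sum_ringing {η : ι → Measure ℝ≥0∞}
    {G : Finset ι → (ι → ℝ≥0∞) → ℝ≥0∞} (hG : ∀ C, Measurable (G C)) :
    ∫⁻ r, G (ringing D t c r) r ∂Measure.pi η =
      ∑ C, ∫⁻ r, (if ringing D t c r = C then G C r else 0) ∂Measure.pi η := by
  rw [← lintegral_finsetSum _ fun C _ => measurable_ite_ringing C (hG C) measurable_const]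
  simp

/-- When the first clocks ring, the residual times of the other clocks are as good as new. -/
theorem Memoryless.renewal {η : ι → Measure ℝ≥0∞} [∀ i, IsProbabilityMeasure (η i)]
    (h : ∀ i, Memoryless (η i)) (htc : t ≤ c) (ht : t ≠ ⊤)
    {F : ℝ≥0∞ → Finset ι → (ι → ℝ≥0∞) → ℝ≥0∞}
    (hF : ∀ C, Measurable fun z : ℝ≥0∞ × (ι → ℝ≥0∞) => F z.1 C z.2)
    (hFD : ∀ m C f g, (∀ i, D i → i ∉ C → f i = g i) → F m C f = F m C g) :
    ∫⁻ r, F (firstRing D t c r) (ringing D t c r) (fun i => t + r i) ∂Measure.pi η =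
      ∫⁻ r, ∫⁻ r', F (firstRing D t c r) (ringing D t c r) (fun i => firstRing D t c r + r' i)
        ∂Measure.pi η ∂Measure.pi η := by
  have hm1 : ∀ C, Measurable fun r : ι → ℝ≥0∞ => F (firstRing D t c r) C (fun i => t + r i) :=
    fun C => (hF C).comp (measurable_firstRing.prodMk (by fun_prop))
  have hm1' : ∀ C, Measurable fun r : ι → ℝ≥0∞ =>
      F (firstRing (· ∈ C) t c r) C (fun i => t + r i) :=
    fun C => (hF C).comp (measurable_firstRing.prodMk (by fun_prop))
  have hm2 : ∀ C, Measurable fun r : ι → ℝ≥0∞ =>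
      ∫⁻ r', F (firstRing D t c r) C (fun i => firstRing D t c r + r' i) ∂Measure.pi η := by
    intro C
    refine Measurable.lintegral_prod_right' (f := fun z : (ι → ℝ≥0∞) × (ι → ℝ≥0∞) =>
      F (firstRing D t c z.1) C (fun i => firstRing D t c z.1 + z.2 i)) ?_
    have hfr : Measurable fun z : (ι → ℝ≥0∞) × (ι → ℝ≥0∞) => firstRing D t c z.1 :=
      measurable_firstRing.comp measurable_fst
    exact (hF C).comp (hfr.prodMk (measurable_pi_lambda _ fun i => hfr.add (by fun_prop)))
  rw [lintegral_eq_sum_ringing (G := fun C r => F (firstRing D t c r) C (fun i => t + r i)) hm1,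
    lintegral_eq_sum_ringing (G := fun C r => ∫⁻ r', F (firstRing D t c r) C
      (fun i => firstRing D t c r + r' i) ∂Measure.pi η) hm2]
  refine Finset.sum_congr rfl fun C _ => ?_
  have hs : Measurable fun r : ι → ℝ≥0∞ => firstRing (· ∈ C) t c r - t :=
    measurable_firstRing.sub_const _
  have hA : MeasurableSet {r : ι → ℝ≥0∞ | ∀ i ∈ C, D i ∧ t + r i ≤ firstRing (· ∈ C) t c r} := by
    simp only [Set.ofPred_forall]
    refine .iInter fun i => .iInter fun _ => ?_
    refine (MeasurableSet.const _).inter (measurableSet_le ?_ measurable_firstRing)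
    fun_prop
  -- `p` collects the clocks that are still running after the first ring; only these have a residual
  -- time to be redrawn.
  obtain ⟨p, hp⟩ : ∃ p : ι → Prop, ∀ i, p i ↔ D i ∧ i ∉ C := ⟨_, fun _ => Iff.rfl⟩
  have hring := ringing_eq_iff (D := D) htc ht C
  simp only [← hp] at hring
  have hcongr : ∀ r r' : ι → ℝ≥0∞, (∀ i, ¬ p i → r i = r' i) →
      ∀ i ∈ C, r i = r' i := fun r r' hr i hi => hr i fun h' => ((hp i).1 h').2 hi
  have hite : Measurable fun r : ι → ℝ≥0∞ =>
      if ∀ i ∈ C, D i ∧ t + r i ≤ firstRing (· ∈ C) t c r then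
        F (firstRing (· ∈ C) t c r) C (fun i => t + r i) else 0 :=
    Measurable.ite hA (hm1' C) measurable_const
  have := Memoryless.lintegral h p hs
    (fun r r' hr => by
      rw [firstRing_congr (D := (· ∈ C)) (hcongr r r' hr)])
    hite
  calc _ = ∫⁻ r, (if ∀ i, p i → firstRing (· ∈ C) t c r - t < r i then
          (if ∀ i ∈ C, D i ∧ t + r i ≤ firstRing (· ∈ C) t c r then
            F (firstRing (· ∈ C) t c r) C (fun i => t + r i) else 0) else 0) ∂Measure.pi η := by
        refine lintegral_congr fun r => ?_
        rw [← ite_and]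
        refine ite_congr (propext (hring r)) (fun hr => ?_) fun _ => rfl
        rw [firstRing_eq_of_ringing_eq ((hring r).2 hr)]
    _ = _ := this
    _ = _ := by
        refine lintegral_congr fun r => ?_
        have hpw : ∀ r' : ι → ℝ≥0∞, ∀ i ∈ C, (if p i then
            firstRing (· ∈ C) t c r - t + r' i else r i) = r i := fun r' i hi => by simp [hp, hi]
        have hfr : ∀ r' : ι → ℝ≥0∞, firstRing (· ∈ C) t c (fun i => if p i then
            firstRing (· ∈ C) t c r - t + r' i else r i) = firstRing (· ∈ C) t c r :=
          fun r' => firstRing_congr (hpw r')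
        have hcond : ∀ r' : ι → ℝ≥0∞, (∀ i ∈ C, D i ∧ t + (if p i then
            firstRing (· ∈ C) t c r - t + r' i else r i) ≤ firstRing (· ∈ C) t c r) ↔
            ∀ i ∈ C, D i ∧ t + r i ≤ firstRing (· ∈ C) t c r := fun r' =>
          forall₂_congr fun i hi => by rw [hpw r' i hi]
        simp only [hfr, hcond]
        by_cases h1 : ∀ i, p i → firstRing (· ∈ C) t c r - t < r i
        · by_cases h2 : ∀ i ∈ C, D i ∧ t + r i ≤ firstRing (· ∈ C) t c r
          · have hr := (hring r).2 ⟨h1, h2⟩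
            rw [if_pos h1, if_pos hr]
            refine lintegral_congr fun r' => ?_
            rw [if_pos h2, firstRing_eq_of_ringing_eq hr]
            -- The conclusion redraws all coordinates whereas only those in `p` have been redrawn
            -- here; `F` does not see the difference.
            refine hFD _ _ _ _ fun i hi hiC => ?_
            rw [if_pos ((hp i).2 ⟨hi, hiC⟩), ← add_assoc, add_tsub_cancel_of_le (le_firstRing htc r)]
          · rw [if_pos h1, if_neg fun hr => h2 ((hring r).1 hr).2]
            simp [h2]
        · rw [if_neg h1, if_neg fun hr => h1 ((hring r).1 hr).1]

end Renewal

/-! ### Measurability of the dynamics -/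

section Measurability

variable {G : Network} {R : Type*}

instance instMeasurableSpaceState (G : Network) : MeasurableSpace (State G) :=
  MeasurableSpace.comap
    (fun x => (x.time, x.recv, x.serve, x.queue, x.finish, x.count, x.review, x.hist)) inferInstance

instance instMeasurableSpaceInput (G : Network) (R : Type*) [MeasurableSpace R] :
    MeasurableSpace (Input G R) :=
  MeasurableSpace.comap (fun i => (i.gen, i.arr, i.tx, i.seed)) inferInstance

section

variable {α : Type*} [MeasurableSpace α]

lemma measurable_obs_iff {f : α → Obs G} :
    Measurable f ↔ Measurable (fun a => (f a).time) ∧ Measurable (fun a => (f a).recv) ∧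
      Measurable (fun a => (f a).inService) ∧ Measurable (fun a => (f a).avail) ∧
      Measurable (fun a => (f a).gen) := by
  simp only [measurable_comap_iff, measurable_fun_prod, Function.comp_def]

lemma measurable_state_iff {f : α → State G} :
    Measurable f ↔ Measurable (fun a => (f a).time) ∧ Measurable (fun a => (f a).recv) ∧
      Measurable (fun a => (f a).serve) ∧ Measurable (fun a => (f a).queue) ∧
      Measurable (fun a => (f a).finish) ∧ Measurable (fun a => (f a).count) ∧
      Measurable (fun a => (f a).review) ∧ Measurable (fun a => (f a).hist) := by
  simp only [measurable_comap_iff, measurable_fun_prod, Function.comp_def]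

lemma measurable_input_iff [MeasurableSpace R] {f : α → Input G R} :
    Measurable f ↔ Measurable (fun a => (f a).gen) ∧ Measurable (fun a => (f a).arr) ∧
      Measurable (fun a => (f a).tx) ∧ Measurable (fun a => (f a).seed) := by
  simp only [measurable_comap_iff, measurable_fun_prod, Function.comp_def]

end

@[fun_prop]
lemma Obs.measurable_time : Measurable (Obs.time : Obs G → _) := (measurable_obs_iff.1 measurable_id).1

@[fun_prop]
lemma Obs.measurable_recv : Measurable (Obs.recv : Obs G → _) :=
  (measurable_obs_iff.1 measurable_id).2.1

@[fun_prop]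
lemma Obs.measurable_inService : Measurable (Obs.inService : Obs G → _) :=
  (measurable_obs_iff.1 measurable_id).2.2.1

@[fun_prop]
lemma Obs.measurable_avail : Measurable (Obs.avail : Obs G → _) :=
  (measurable_obs_iff.1 measurable_id).2.2.2.1

@[fun_prop]
lemma State.measurable_time : Measurable (State.time : State G → _) :=
  (measurable_state_iff.1 measurable_id).1

@[fun_prop]
lemma State.measurable_recv : Measurable (State.recv : State G → _) :=
  (measurable_state_iff.1 measurable_id).2.1

@[fun_prop]
lemma State.measurable_serve : Measurable (State.serve : State G → _) :=
  (measurable_state_iff.1 measurable_id).2.2.1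

@[fun_prop]
lemma State.measurable_queue : Measurable (State.queue : State G → _) :=
  (measurable_state_iff.1 measurable_id).2.2.2.1

@[fun_prop]
lemma State.measurable_finish : Measurable (State.finish : State G → _) :=
  (measurable_state_iff.1 measurable_id).2.2.2.2.1

@[fun_prop]
lemma State.measurable_count : Measurable (State.count : State G → _) :=
  (measurable_state_iff.1 measurable_id).2.2.2.2.2.1

@[fun_prop]
lemma State.measurable_review : Measurable (State.review : State G → _) :=
  (measurable_state_iff.1 measurable_id).2.2.2.2.2.2.1

@[fun_prop]
lemma State.measurable_hist : Measurable (State.hist : State G → _) :=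
  (measurable_state_iff.1 measurable_id).2.2.2.2.2.2.2

variable [MeasurableSpace R]

@[fun_prop]
lemma Input.measurable_gen : Measurable (Input.gen : Input G R → _) :=
  (measurable_input_iff.1 measurable_id).1

@[fun_prop]
lemma Input.measurable_arr : Measurable (Input.arr : Input G R → _) :=
  (measurable_input_iff.1 measurable_id).2.1

@[fun_prop]
lemma Input.measurable_tx : Measurable (Input.tx : Input G R → _) :=
  (measurable_input_iff.1 measurable_id).2.2.1

@[fun_prop]
lemma Input.measurable_seed : Measurable (Input.seed : Input G R → _) :=
  (measurable_input_iff.1 measurable_id).2.2.2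

variable {α : Type*} [MeasurableSpace α] {f : α → State G} {g : α → Input G R}

lemma measurable_eq_optionNat {u v : α → Option ℕ} (hu : Measurable u) (hv : Measurable v) :
    Measurable fun a => u a = v a := by
  have : Measurable fun z : Option ℕ × Option ℕ => z.1 = z.2 := Measurable.of_discrete
  exact this.comp (hu.prodMk hv)

@[fun_prop]
lemma State.measurable_nextTime (hf : Measurable f) (hg : Measurable g) :
    Measurable fun a => (f a).nextTime (g a) := by
  unfold State.nextTime
  refine Measurable.min (.iInf fun e => by fun_prop) (Measurable.min (.iInf fun l => ?_)
    (by fun_prop))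
  -- An infimum over a proposition is a function defined by cases, with value `⊤` where the
  -- proposition fails.
  have : (fun a => ⨅ _ : (f a).time < (g a).arr l, (g a).arr l) =
      {a | (f a).time < (g a).arr l}.piecewise (fun a => (g a).arr l) fun _ => ⊤ := by
    funext a
    by_cases h : (f a).time < (g a).arr l
    · simp [Set.piecewise, h]
    · simp [Set.piecewise, h]
  rw [this]
  exact Measurable.piecewise (measurableSet_lt (by fun_prop) (by fun_prop)) (by fun_prop)
    measurable_const

@[fun_prop]
lemma State.measurable_completes (hf : Measurable f) (hg : Measurable g) (e : G.Link) :
    Measurable fun a => (f a).Completes (g a) e := by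
  unfold State.Completes
  refine Measurable.and (Measurable.not (measurable_eq_optionNat (by fun_prop) measurable_const)) ?_
  exact measurableSet_setOfPred.1 (measurableSet_le (by fun_prop) (by fun_prop))

@[fun_prop]
lemma State.measurable_nextRecv (hf : Measurable f) (hg : Measurable g) (j : G.Node) :
    Measurable fun a => (f a).nextRecv (g a) j := by
  refine measurable_set_iff.2 fun l => ?_
  simp only [State.nextRecv, Set.mem_union, Set.mem_ofPred_eq]
  refine Measurable.or (Measurable.or ?_ ?_) ?_
  · exact measurable_set_iff.1 (by fun_prop) l
  · refine Measurable.exists fun e => Measurable.and measurable_const (Measurable.and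
      (by fun_prop) (measurable_eq_optionNat (by fun_prop) measurable_const))
  · refine Measurable.and measurable_const ?_
    exact measurableSet_setOfPred.1 (measurableSet_le (by fun_prop) (by fun_prop))

@[fun_prop]
lemma State.measurable_nextObs (hf : Measurable f) (hg : Measurable g) :
    Measurable fun a => (f a).nextObs (g a) := by
  refine measurable_obs_iff.2 ⟨by simp only [State.nextObs]; fun_prop,
    measurable_pi_lambda _ fun j => by simp only [State.nextObs]; fun_prop,
    measurable_pi_lambda _ fun e => ?_, measurable_pi_lambda _ fun e => ?_,
    measurable_pi_lambda _ fun l => ?_⟩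
  · simp only [State.nextObs]
    exact Measurable.ite (measurableSet_setOfPred.2 (by fun_prop)) measurable_const (by fun_prop)
  · refine measurable_set_iff.2 fun l => ?_
    simp only [State.nextObs, Set.mem_union, Set.mem_ofPred_eq, Set.mem_sdiff]
    have h1 : Measurable fun a => l ∈ (f a).queue e := measurable_set_iff.1 (by fun_prop) l
    have h2 : Measurable fun a => (f a).serve e = some l :=
      measurable_eq_optionNat (by fun_prop) measurable_const
    have h3 : Measurable fun a => l ∈ (f a).nextRecv (g a) (G.src e) :=
      measurable_set_iff.1 (by fun_prop) l
    have h4 : Measurable fun a => l ∈ (f a).recv (G.src e) :=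
      measurable_set_iff.1 (by fun_prop) l
    fun_prop
  · simp only [State.nextObs]
    have h3 : Measurable fun a => l ∈ (f a).nextRecv (g a) 0 :=
      measurable_set_iff.1 (by fun_prop) l
    exact Measurable.ite (measurableSet_setOfPred.2 h3) (by fun_prop) measurable_const

@[fun_prop]
lemma State.measurable_nextHist (hf : Measurable f) (hg : Measurable g) (k : ℕ) :
    Measurable fun a => (f a).nextHist (g a) k := by
  refine measurable_pi_lambda _ fun i => ?_
  simp only [State.nextHist, Function.update_apply]
  split_ifs <;> fun_prop

variable (π : Policy G R)

@[fun_prop]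
lemma State.measurable_nextServe (hf : Measurable f) (hg : Measurable g) (k : ℕ) (e : G.Link) :
    Measurable fun a => (f a).nextServe π (g a) k e :=
  (measurable_pi_apply e).comp ((π.measurable_serve k).comp
    (f := fun a => ((g a).seed, (f a).nextHist (g a) k)) (by fun_prop))

@[fun_prop]
lemma State.measurable_nextQueue (hf : Measurable f) (hg : Measurable g) (k : ℕ) (e : G.Link) :
    Measurable fun a => (f a).nextQueue π (g a) k e :=
  (measurable_pi_apply e).comp ((π.measurable_queue k).comp
    (f := fun a => ((g a).seed, (f a).nextHist (g a) k)) (by fun_prop))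

@[fun_prop]
lemma State.measurable_next (hf : Measurable f) (hg : Measurable g) (k : ℕ) :
    Measurable fun a => (f a).next π (g a) k := by
  have hI : ∀ e, Measurable fun a => ((f a).nextObs (g a)).inService e := fun e =>
    (measurable_pi_apply e).comp (Obs.measurable_inService.comp (State.measurable_nextObs hf hg))
  have h1 : ∀ e, Measurable fun a => (f a).nextServe π (g a) k e = none := fun e =>
    measurable_eq_optionNat (by fun_prop) measurable_const
  have h2 : ∀ e, Measurable fun a =>
      (f a).nextServe π (g a) k e = ((f a).nextObs (g a)).inService e := fun e =>
    measurable_eq_optionNat (by fun_prop) (hI e)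
  refine measurable_state_iff.2 ⟨?_, ?_, ?_, ?_, ?_, ?_, ?_, ?_⟩ <;> simp only [State.next]
  · fun_prop
  · exact measurable_pi_lambda _ fun j => by fun_prop
  · exact measurable_pi_lambda _ fun e => by fun_prop
  · exact measurable_pi_lambda _ fun e => by fun_prop
  · refine measurable_pi_lambda _ fun e => ?_
    refine Measurable.ite (measurableSet_setOfPred.2 (h1 e)) measurable_const
      (Measurable.ite (measurableSet_setOfPred.2 (h2 e)) (by fun_prop) ?_)
    refine Measurable.add (by fun_prop) (ENNReal.measurable_ofReal.comp ?_)
    have : Measurable fun z : (ℕ → ℝ) × ℕ => z.1 z.2 :=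
      measurable_from_prod_countable_left fun n => measurable_pi_apply n
    exact this.comp (f := fun a => ((g a).tx e, (f a).count e)) (by fun_prop)
  · refine measurable_pi_lambda _ fun e => ?_
    refine Measurable.ite (measurableSet_setOfPred.2 ((h1 e).or (h2 e))) (by fun_prop)
      (by fun_prop)
  · refine Measurable.add (by fun_prop) ((π.measurable_timer k).comp
      (f := fun a => ((g a).seed, (f a).nextHist (g a) k)) (by fun_prop))
  · fun_prop

@[fun_prop]
lemma measurable_run (hg : Measurable g) (k : ℕ) : Measurable fun a => run π (g a) k := by
  induction k with
  | zero => exact measurable_const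
  | succ k ih =>
    simp only [run]
    fun_prop

open Classical in
lemma measurable_deliveryTime (hg : Measurable g) (l : ℕ) (j : G.Node) :
    Measurable fun a => deliveryTime π (g a) l j := by
  refine .iInf fun k => ?_
  have : (fun a => ⨅ _ : l ∈ (run π (g a) k).recv j, (run π (g a) k).time) =
      {a | l ∈ (run π (g a) k).recv j}.piecewise (fun a => (run π (g a) k).time) fun _ => ⊤ := by
    funext a
    by_cases h : l ∈ (run π (g a) k).recv j
    · simp [Set.piecewise, h]
    · simp [Set.piecewise, h]
  rw [this]
  exact Measurable.piecewise (measurableSet_setOfPred.2 (measurable_set_iff.1 (by fun_prop) l))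
    (by fun_prop) measurable_const

open Classical in
-- Replaces a supremum over a random set of packets by a countable supremum with a fixed index set,
-- which is visibly measurable. The two sets of values coincide, so boundedness is not an issue.
lemma sSup_insert_zero_eq_iSup (p : ℕ → Prop) (s : ℕ → ℝ≥0) :
    sSup (insert 0 {x | ∃ l, p l ∧ x = s l}) = ⨆ o : Option ℕ,
      o.elim 0 fun l => if p l then s l else 0 := by
  rw [iSup]
  congr 1
  ext x
  simp only [Set.mem_insert_iff, Set.mem_ofPred_eq, Set.mem_range]
  constructor
  · rintro (rfl | ⟨l, hl, rfl⟩)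
    · exact ⟨none, rfl⟩
    · exact ⟨some l, by simp [hl]⟩
  · rintro ⟨o, rfl⟩
    cases o with
    | none => left; rfl
    | some l =>
      by_cases hl : p l
      · right; exact ⟨l, hl, by simp [hl]⟩
      · left; simp [hl]

lemma measurable_sSup_insert_zero {p : ℕ → α → Prop} (hp : ∀ l, Measurable (p l))
    {s : ℕ → α → ℝ≥0} (hs : ∀ l, Measurable (s l)) :
    Measurable fun a => sSup (insert 0 {x | ∃ l, p l a ∧ x = s l a}) := by
  classical
  simp only [sSup_insert_zero_eq_iSup]
  refine .iSup fun o => ?_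
  cases o with
  | none => exact measurable_const
  | some l => exact Measurable.ite (measurableSet_setOfPred.2 (hp l)) (hs l) measurable_const

lemma measurable_age (hg : Measurable g) (t : ℝ≥0) : Measurable fun a => age π (g a) t := by
  refine measurable_pi_lambda _ fun j => ?_
  refine Measurable.const_sub (measurable_coe_nnreal_real.comp ?_) _
  refine measurable_sSup_insert_zero (fun l => ?_) fun l => by fun_prop
  exact measurableSet_setOfPred.1 (measurableSet_le (measurable_deliveryTime π hg l j)
    measurable_const)

end Measurability

/-! ### Values of a run and of its memoryless version -/

section Values

variable {G : Network} {R : Type*}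

instance instIsProbabilityMeasureExp (e : G.Link) : IsProbabilityMeasure (expMeasure (G.rate e)) :=
  isProbabilityMeasure_expMeasure (G.rate_pos e)

instance instIsProbabilityMeasureClock (e : G.Link) :
    IsProbabilityMeasure (expClock (G.rate e)) :=
  isProbabilityMeasure_expClock (G.rate_pos e)

/-- The joint law of the residual transmission times. -/
noncomputable def clockLaw (G : Network) : Measure (G.Link → ℝ≥0∞) :=
  Measure.pi fun e => expClock (G.rate e)

/-- The joint law of all transmission times. -/
noncomputable def txLaw (G : Network) : Measure (G.Link × ℕ → ℝ) :=
  Measure.infinitePi fun p => expMeasure (G.rate p.1)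

instance : IsProbabilityMeasure (clockLaw G) := by unfold clockLaw; infer_instance

instance : IsProbabilityMeasure (txLaw G) := by unfold txLaw; infer_instance

lemma clockLaw_ae_pos : ∀ᵐ r ∂clockLaw G, ∀ e, 0 < r e := by
  refine ae_all_iff.2 fun e => ?_
  exact (Measure.quasiMeasurePreserving_eval
    (μ := fun e : G.Link => expClock (G.rate e)) e).ae (expClock_ae_pos (G.rate_pos e))

/-- The next unused duration of each link: distinct links read distinct coordinates, so these
durations are independent and form one vector of clocks. -/
lemma map_txLaw (c : G.Link → ℕ) :
    (txLaw G).map (fun tx e => ENNReal.ofReal (tx (e, c e))) = clockLaw G := by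
  have h1 : (txLaw G).map (fun tx e => tx (e, c e)) =
      Measure.infinitePi fun e => expMeasure (G.rate e) :=
    Measure.map_infinitePi_infinitePi_of_inj (P := fun p : G.Link × ℕ => expMeasure (G.rate p.1))
      (f := fun e => (e, c e)) fun e e' h => (Prod.ext_iff.1 h).1
  have h2 : (txLaw G).map (fun tx e => ENNReal.ofReal (tx (e, c e))) =
      ((txLaw G).map (fun tx e => tx (e, c e))).map (fun r e => ENNReal.ofReal (r e)) := by
    rw [Measure.map_map (by fun_prop) (by fun_prop)]
    rfl
  rw [h2, h1, Measure.infinitePi_eq_pi, Measure.pi_map_pi fun e => by fun_prop]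
  rfl

/-- The input with the transmission times replaced. -/
def Input.withTx (inp : Input G R) (tx : G.Link × ℕ → ℝ) : Input G R :=
  { inp with tx := fun e k => tx (e, k) }

/-- The state with the residual transmission times replaced by `r`, counted from time `t`. -/
noncomputable def State.withClock (x : State G) (t : ℝ≥0∞) (r : G.Link → ℝ≥0∞) : State G :=
  { x with finish := fun e => if x.serve e = none then ⊤ else t + r e }

/-- The time of the next arrival or review. -/
noncomputable def State.deadline (x : State G) (inp : Input G R) : ℝ≥0∞ :=
  min (⨅ l, ⨅ _ : x.time < inp.arr l, inp.arr l) x.review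

/-- Together with `State.completes_withClock`, this presents an epoch as the first ring among the
clocks of the busy links, capped by the deadline, so that `Memoryless.renewal` applies to it. -/
lemma State.nextTime_withClock (x : State G) (inp : Input G R) (t : ℝ≥0∞)
    (r : G.Link → ℝ≥0∞) :
    (x.withClock t r).nextTime inp =
      firstRing (fun e => x.serve e ≠ none) t (x.deadline inp) r := by
  simp only [State.nextTime, firstRing, State.deadline, State.withClock]
  congr 2
  funext e
  by_cases h : x.serve e = none <;> simp [h]

lemma State.completes_withClock (x : State G) (inp : Input G R) (t : ℝ≥0∞)
    (r : G.Link → ℝ≥0∞) (e : G.Link) :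
    (x.withClock t r).Completes inp e ↔
      e ∈ ringing (fun e => x.serve e ≠ none) t (x.deadline inp) r := by
  rw [mem_ringing, ← State.nextTime_withClock, State.Completes]
  refine and_congr_right fun h => ?_
  have h' : x.serve e ≠ none := h
  simp [State.withClock, h']

lemma State.nextRecv_congr {x : State G} {f : G.Link → ℝ≥0∞} {inp : Input G R}
    (hT : ({ x with finish := f } : State G).nextTime inp = x.nextTime inp)
    (hC : ∀ e, ({ x with finish := f } : State G).Completes inp e ↔ x.Completes inp e) :
    ({ x with finish := f } : State G).nextRecv inp = x.nextRecv inp := by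
  funext j
  simp only [State.nextRecv, hT, hC]

open Classical in
-- Finish times enter an observation only through the time of the epoch and the set of completing
-- links. Here causality comes in: decisions are blind to residual times, which may therefore be
-- redrawn.
lemma State.nextObs_congr {x : State G} {f : G.Link → ℝ≥0∞} {inp : Input G R}
    (hT : ({ x with finish := f } : State G).nextTime inp = x.nextTime inp)
    (hC : ∀ e, ({ x with finish := f } : State G).Completes inp e ↔ x.Completes inp e) :
    ({ x with finish := f } : State G).nextObs inp = x.nextObs inp := by
  simp only [State.nextObs, State.nextRecv_congr hT hC, hT, hC]

variable [MeasurableSpace R]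

/-- The decisions taken at epoch `k`, which follows the state `x`, concern available packets only;
if `lg` holds, every link with available packets sends one with the largest generation time. -/
def State.Sound (lg : Prop) (π : Policy G R) (inp : Input G R) (k : ℕ) (x : State G) : Prop :=
  ∀ e : G.Link, (∀ l, x.nextServe π inp k e = some l → l ∈ (x.nextObs inp).avail e) ∧
    x.nextQueue π inp k e ⊆ (x.nextObs inp).avail e ∧
    (lg → ((x.nextObs inp).avail e).Nonempty → ∃ l, x.nextServe π inp k e = some l ∧
      ∀ l' ∈ (x.nextObs inp).avail e, inp.gen l' ≤ inp.gen l)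

lemma State.measurable_sound {α : Type*} [MeasurableSpace α] {f : α → State G}
    {g : α → Input G R} (lg : Prop) (π : Policy G R) (hf : Measurable f) (hg : Measurable g)
    (k : ℕ) : Measurable fun a => (f a).Sound lg π (g a) k := by
  have hS : ∀ e l, Measurable fun a => (f a).nextServe π (g a) k e = some l := fun e l =>
    measurable_eq_optionNat (by fun_prop) measurable_const
  have hA : ∀ e l, Measurable fun a => l ∈ ((f a).nextObs (g a)).avail e := fun e l =>
    measurable_set_iff.1 ((measurable_pi_apply e).comp
      (Obs.measurable_avail.comp (State.measurable_nextObs hf hg))) l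
  have hQ : ∀ e l, Measurable fun a => l ∈ (f a).nextQueue π (g a) k e := fun e l =>
    measurable_set_iff.1 (by fun_prop) l
  have hG : ∀ l l', Measurable fun a => (g a).gen l' ≤ (g a).gen l := fun l l' =>
    measurableSet_setOfPred.1 (measurableSet_le (by fun_prop) (by fun_prop))
  unfold State.Sound
  simp only [Set.subset_def, Set.Nonempty]
  refine Measurable.forall fun e => ((Measurable.forall fun l => (hS e l).imp (hA e l)).and
    ((Measurable.forall fun l => (hQ e l).imp (hA e l)).and (measurable_const.imp
      ((Measurable.exists fun l => hA e l).imp (Measurable.exists fun l => (hS e l).and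
        (Measurable.forall fun l' => (hA e l').imp (hG l l')))))))

/-- The parameters of the valuation of a run: the horizon, the value of a history that reaches the
horizon, and the value of the other runs. -/
structure Valuation (G : Network) (R : Type*) where
  horizon : ℝ≥0
  score : (ℕ → ℝ≥0) → (ℕ → Obs G) → ℝ≥0∞
  other : ℝ≥0∞
  lg : Prop

variable (w : Valuation G R) (π : Policy G R)

open Classical in
/-- The value of a run that continues from state `x` with epoch `k`, when the run after this epoch
is valued by `V`. -/
noncomputable def stepValue (V : State G → ℝ≥0∞) (inp : Input G R) (k : ℕ) (x : State G) : ℝ≥0∞ :=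
  if (w.horizon : ℝ≥0∞) < x.nextTime inp then w.score inp.gen x.hist
  else if x.Sound w.lg π inp k then V (x.next π inp k) else w.other

/-- The value of the run that continues from state `x` with epoch `k`, if it reaches the horizon
within `n` epochs. -/
noncomputable def runValue (inp : Input G R) : ℕ → ℕ → State G → ℝ≥0∞
  | 0, _, _ => w.other
  | n + 1, k, x => stepValue w π (runValue inp n (k + 1)) inp k x

/-- The expected value of the run that continues from state `x` at time `t`, when at each epoch all
residual transmission times are drawn anew. -/
noncomputable def freshValue (inp : Input G R) : ℕ → ℕ → State G → ℝ≥0∞ → ℝ≥0∞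
  | 0, _, _, _ => w.other
  | n + 1, k, x, t => ∫⁻ r, stepValue w π (fun y => freshValue inp n (k + 1) y y.time) inp k
      (x.withClock t r) ∂clockLaw G

variable {w π}

lemma State.sound_congr {x : State G} {f : G.Link → ℝ≥0∞} {inp : Input G R} {k : ℕ}
    (lg : Prop)
    (hT : ({ x with finish := f } : State G).nextTime inp = x.nextTime inp)
    (hC : ∀ e, ({ x with finish := f } : State G).Completes inp e ↔ x.Completes inp e) :
    ({ x with finish := f } : State G).Sound lg π inp k ↔ x.Sound lg π inp k := by
  simp only [State.Sound, State.nextServe, State.nextQueue, State.nextHist,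
    State.nextObs_congr hT hC]

/-- Durations with index below the current count have been used up and are never read again. -/
lemma runValue_congr_tx {inp : Input G R} {tx tx' : G.Link × ℕ → ℝ} (n k : ℕ) {x : State G}
    (h : ∀ e i, x.count e ≤ i → tx (e, i) = tx' (e, i)) :
    runValue w π (inp.withTx tx) n k x = runValue w π (inp.withTx tx') n k x := by
  induction n generalizing k x with
  | zero => rfl
  | succ n ih =>
    have h1 : x.next π (inp.withTx tx) k = x.next π (inp.withTx tx') k := by
      have : ∀ e, (inp.withTx tx).tx e (x.count e) = (inp.withTx tx').tx e (x.count e) :=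
        fun e => h e _ le_rfl
      simp only [State.next, this]
      rfl
    simp only [runValue, stepValue]
    rw [h1, ih]
    · rfl
    · intro e i hi
      refine h e i (le_trans ?_ hi)
      simp only [State.next]
      split_ifs <;> omega

section

variable {α : Type*} [MeasurableSpace α] {f : α → State G} {g : α → Input G R}

lemma measurable_stepValue (hw : Measurable fun z : (ℕ → ℝ≥0) × (ℕ → Obs G) => w.score z.1 z.2)
    (hf : Measurable f) (hg : Measurable g) {V : α → State G → ℝ≥0∞}
    (k : ℕ) (hV : Measurable fun a => V a ((f a).next π (g a) k)) :
    Measurable fun a => stepValue w π (V a) (g a) k (f a) := by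
  unfold stepValue
  refine Measurable.ite (measurableSet_lt measurable_const (by fun_prop)) ?_
    (Measurable.ite (measurableSet_setOfPred.2 (State.measurable_sound _ _ hf hg k)) hV
      measurable_const)
  exact hw.comp (f := fun a => ((g a).gen, (f a).hist)) (by fun_prop)

lemma measurable_runValue (hw : Measurable fun z : (ℕ → ℝ≥0) × (ℕ → Obs G) => w.score z.1 z.2)
    (hf : Measurable f) (hg : Measurable g) (n k : ℕ) :
    Measurable fun a => runValue w π (g a) n k (f a) := by
  induction n generalizing k f with
  | zero => exact measurable_const
  | succ n ih =>
    exact measurable_stepValue hw hf hg k (ih (by fun_prop) (k + 1))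

lemma measurable_withClock {u : α → ℝ≥0∞} {r : α → G.Link → ℝ≥0∞} (hf : Measurable f)
    (hu : Measurable u) (hr : Measurable r) :
    Measurable fun a => (f a).withClock (u a) (r a) := by
  refine measurable_state_iff.2 ⟨by simp only [State.withClock]; fun_prop,
    by simp only [State.withClock]; fun_prop, by simp only [State.withClock]; fun_prop,
    by simp only [State.withClock]; fun_prop, ?_, by simp only [State.withClock]; fun_prop,
    by simp only [State.withClock]; fun_prop, by simp only [State.withClock]; fun_prop⟩
  refine measurable_pi_lambda _ fun e => ?_
  exact Measurable.ite (measurableSet_setOfPred.2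
    (measurable_eq_optionNat (by fun_prop) measurable_const)) measurable_const (by fun_prop)

lemma measurable_freshValue
    (hw : Measurable fun z : (ℕ → ℝ≥0) × (ℕ → Obs G) => w.score z.1 z.2)
    {α : Type*} [MeasurableSpace α] {f : α → State G} {g : α → Input G R}
    {u : α → ℝ≥0∞} (hf : Measurable f) (hg : Measurable g) (hu : Measurable u) (n k : ℕ) :
    Measurable fun a => freshValue w π (g a) n k (f a) (u a) := by
  -- The parameter space `α` is generalized because each integration appends a clock vector to it.
  induction n generalizing k α with
  | zero => exact measurable_const
  | succ n ih =>
    refine Measurable.lintegral_prod_right' (f := fun z : α × (G.Link → ℝ≥0∞) =>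
      stepValue w π (fun y => freshValue w π (g z.1) n (k + 1) y y.time) (g z.1) k
        ((f z.1).withClock (u z.1) z.2)) ?_
    have h1 : Measurable fun z : α × (G.Link → ℝ≥0∞) => (f z.1).withClock (u z.1) z.2 :=
      measurable_withClock (by fun_prop) (by fun_prop) (by fun_prop)
    have h2 : Measurable fun z : α × (G.Link → ℝ≥0∞) => g z.1 := by fun_prop
    have h3 : Measurable fun z : α × (G.Link → ℝ≥0∞) =>
        ((f z.1).withClock (u z.1) z.2).next π (g z.1) k := State.measurable_next _ h1 h2 k
    exact measurable_stepValue hw h1 h2 k (ih h3 h2 (State.measurable_time.comp h3) (k + 1))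

end

end Values

/-! ### The run has the same value as its memoryless version -/

section Bridge

open Classical

variable {G : Network} {R : Type*}

/-- For the links in `p` that start a transmission: the duration `(e, c e)` is read once, as a
clock, and ignored afterwards. It is thus independent of everything that `Ψ` still uses and can be
exchanged for the clock `r e`. -/
lemma lintegral_resample_tx {Ψ : (G.Link → ℝ≥0∞) → (G.Link × ℕ → ℝ) → ℝ≥0∞}
    (hΨ : Measurable fun z : (G.Link → ℝ≥0∞) × (G.Link × ℕ → ℝ) => Ψ z.1 z.2)
    (c : G.Link → ℕ) (p : G.Link → Prop)
    (h : ∀ s tx tx', (∀ e i, (p e → i ≠ c e) → tx (e, i) = tx' (e, i)) → Ψ s tx = Ψ s tx') :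
    ∫⁻ r, ∫⁻ tx, Ψ (fun e => if p e then ENNReal.ofReal (tx (e, c e)) else r e) tx ∂txLaw G
        ∂clockLaw G =
      ∫⁻ r, ∫⁻ tx, Ψ r tx ∂txLaw G ∂clockLaw G := by
  have hm : Measurable fun r => ∫⁻ tx, Ψ r tx ∂txLaw G := hΨ.lintegral_prod_right'
  have hpr : ∀ r : G.Link → ℝ≥0∞, Measurable fun s : G.Link → ℝ≥0∞ =>
      (fun e => if p e then s e else r e) := fun r => by
    refine measurable_pi_lambda _ fun e => ?_
    split_ifs <;> fun_prop
  have hq : Measurable fun (tx : G.Link × ℕ → ℝ) (e : G.Link) => ENNReal.ofReal (tx (e, c e)) := by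
    fun_prop
  have key : ∀ r : G.Link → ℝ≥0∞,
      ∫⁻ tx, Ψ (fun e => if p e then ENNReal.ofReal (tx (e, c e)) else r e) tx ∂txLaw G =
        ∫⁻ s, ∫⁻ tx, Ψ (fun e => if p e then s e else r e) tx ∂txLaw G ∂clockLaw G := by
    intro r
    have hK : Measurable fun tx : G.Link × ℕ → ℝ =>
        Ψ (fun e => if p e then ENNReal.ofReal (tx (e, c e)) else r e) tx :=
      hΨ.comp (((hpr r).comp hq).prodMk measurable_id)
    -- Once the entries `(e, c e)` with `p e` are redrawn, the first argument of `Ψ` reads only the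
    -- redrawn entries and the second, by `h`, does not depend on them.
    rw [txLaw, lintegral_infinitePi_resample _ (fun q => p q.1 ∧ q.2 = c q.1) hK, ← txLaw,
      ← map_txLaw c]
    have hmap := lintegral_map (μ := txLaw G) (hm.comp (hpr r)) hq
    simp only [Function.comp_def] at hmap
    rw [hmap]
    refine lintegral_congr fun tx' => lintegral_congr fun tx => ?_
    refine Eq.trans (congrArg (fun u => Ψ u _) (funext fun e => ?_))
      (h (fun e => if p e then ENNReal.ofReal (tx' (e, c e)) else r e) _ tx
        fun e i hi => if_neg fun h' => hi h'.1 h'.2)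
    by_cases hp : p e <;> simp [hp]
  simp only [key]
  rw [clockLaw, lintegral_pi_resample p hm]

/-- The state in which the links in `C` complete their transmissions at time `m`, and the other
links at the times `f`. -/
noncomputable def State.renewed (x : State G) (C : Finset G.Link) (m : ℝ≥0∞)
    (f : G.Link → ℝ≥0∞) : State G :=
  { x with finish := fun e => if x.serve e = none then ⊤ else if e ∈ C then m else f e }

lemma measurable_renewed (x : State G) (C : Finset G.Link) {α : Type*} [MeasurableSpace α]
    {u : α → ℝ≥0∞} {r : α → G.Link → ℝ≥0∞} (hu : Measurable u) (hr : Measurable r) :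
    Measurable fun a => x.renewed C (u a) (r a) := by
  refine measurable_state_iff.2 ⟨by simp only [State.renewed]; fun_prop,
    by simp only [State.renewed]; fun_prop, by simp only [State.renewed]; fun_prop,
    by simp only [State.renewed]; fun_prop, ?_, by simp only [State.renewed]; fun_prop,
    by simp only [State.renewed]; fun_prop, by simp only [State.renewed]; fun_prop⟩
  refine measurable_pi_lambda _ fun e => ?_
  simp only [State.renewed]
  split_ifs <;> fun_prop

/-- Rewrites the state as a function of the first ring, the ringing set and the remaining clocks.
Since `State.renewed` ignores the clocks in `C` and those of idle links, it meets the hypothesis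
`hFD` of `Memoryless.renewal`. -/
lemma State.renewed_ringing (x : State G) (inp : Input G R) (t : ℝ≥0∞) (r : G.Link → ℝ≥0∞) :
    x.renewed (ringing (fun e => x.serve e ≠ none) t (x.deadline inp) r)
      (firstRing (fun e => x.serve e ≠ none) t (x.deadline inp) r) (fun e => t + r e) =
      x.withClock t r := by
  have : ∀ e, (if x.serve e = none then ⊤ else
      if e ∈ ringing (fun e => x.serve e ≠ none) t (x.deadline inp) r then
        firstRing (fun e => x.serve e ≠ none) t (x.deadline inp) r else t + r e) =
      if x.serve e = none then ⊤ else t + r e := by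
    intro e
    split_ifs with h1 h2
    · rfl
    · exact le_antisymm (firstRing_le_of_mem (D := fun e => x.serve e ≠ none) r h1)
        (mem_ringing.1 h2).2
    · rfl
  simp only [State.renewed, State.withClock, this]

section

variable {x : State G} {inp : Input G R} {t : ℝ≥0∞} {r r' : G.Link → ℝ≥0∞}

/-- Redrawing does not move the epoch: completing links keep their finish time, and the redrawn ones
finish no earlier. -/
lemma State.nextTime_renewed :
    (x.renewed (ringing (fun e => x.serve e ≠ none) t (x.deadline inp) r)
      (firstRing (fun e => x.serve e ≠ none) t (x.deadline inp) r)
      (fun e => firstRing (fun e => x.serve e ≠ none) t (x.deadline inp) r + r' e)).nextTime inp =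
      (x.withClock t r).nextTime inp := by
  rw [State.nextTime_withClock]
  refine le_antisymm ?_ (le_min (le_iInf fun e => ?_) (firstRing_le r))
  · rcases firstRing_eq_or (D := fun e => x.serve e ≠ none) (t := t) (c := x.deadline inp) r with
      h | ⟨e, he, h⟩
    · rw [h]
      exact min_le_right _ _
    · refine (min_le_left _ _).trans ((iInf_le _ e).trans ?_)
      have he' : x.serve e ≠ none := he
      simp [State.renewed, he', mem_ringing, h]
  · simp only [State.renewed]
    split_ifs
    · exact le_top
    · exact le_rfl
    · exact le_self_add

/-- Redrawn clocks must be positive and the epoch finite; otherwise a redrawn link could complete at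
this very epoch. -/
lemma State.completes_renewed (hr' : ∀ e, 0 < r' e)
    (hM : (x.withClock t r).nextTime inp ≠ ⊤) (e : G.Link) :
    (x.renewed (ringing (fun e => x.serve e ≠ none) t (x.deadline inp) r)
      (firstRing (fun e => x.serve e ≠ none) t (x.deadline inp) r)
      (fun e => firstRing (fun e => x.serve e ≠ none) t (x.deadline inp) r + r' e)).Completes
        inp e ↔ (x.withClock t r).Completes inp e := by
  rw [State.completes_withClock, State.Completes, State.nextTime_renewed,
    State.nextTime_withClock]
  rw [State.nextTime_withClock] at hM
  simp only [State.renewed]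
  by_cases h1 : x.serve e = none
  · simp [h1, mem_ringing]
  · by_cases h2 : e ∈ ringing (fun e => x.serve e ≠ none) t (x.deadline inp) r
    · simp [h1, h2]
    · simp only [h1, h2, if_false, ne_eq, not_false_eq_true, true_and, iff_false, not_le]
      exact ENNReal.lt_add_right hM (hr' e).ne'

end

variable [MeasurableSpace R] {w : Valuation G R} {π : Policy G R}

lemma stepValue_of_lt {V : State G → ℝ≥0∞} {inp : Input G R} {k : ℕ} {x : State G}
    (h : (w.horizon : ℝ≥0∞) < x.nextTime inp) :
    stepValue w π V inp k x = w.score inp.gen x.hist := if_pos h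

lemma measurable_withTx (inp : Input G R) : Measurable fun tx => inp.withTx tx := by
  refine measurable_input_iff.2 ⟨by simp only [Input.withTx]; fun_prop,
    by simp only [Input.withTx]; fun_prop, ?_, by simp only [Input.withTx]; fun_prop⟩
  simp only [Input.withTx]
  fun_prop

/-- The link `e` starts a new transmission at epoch `k`, which follows the state `x`. -/
def State.Starts (π : Policy G R) (x : State G) (inp : Input G R) (k : ℕ) (e : G.Link) : Prop :=
  x.nextServe π inp k e ≠ none ∧ x.nextServe π inp k e ≠ (x.nextObs inp).inService e

lemma State.finish_withClock_of_none {x : State G} {e : G.Link} (h : x.serve e = none)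
    (t : ℝ≥0∞) (r : G.Link → ℝ≥0∞) : (x.withClock t r).finish e = ⊤ := if_pos h

lemma State.finish_withClock_of_ne {x : State G} {e : G.Link} (h : x.serve e ≠ none)
    (t : ℝ≥0∞) (r : G.Link → ℝ≥0∞) : (x.withClock t r).finish e = t + r e := if_neg h

/-- One epoch after a renewal: the transmissions that go on have new residual times, and the
transmissions that start have independent transmission times. -/
lemma State.next_renewed {x : State G} {inp : Input G R} {t : ℝ≥0∞} {r r' : G.Link → ℝ≥0∞}
    (hr' : ∀ e, 0 < r' e) (hM : (x.withClock t r).nextTime inp ≠ ⊤) (k : ℕ)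
    (tx : G.Link × ℕ → ℝ) :
    (x.renewed (ringing (fun e => x.serve e ≠ none) t (x.deadline inp) r)
      (firstRing (fun e => x.serve e ≠ none) t (x.deadline inp) r)
      (fun e => firstRing (fun e => x.serve e ≠ none) t (x.deadline inp) r + r' e)).next π
        (inp.withTx tx) k =
      ((x.withClock t r).next π inp k).withClock ((x.withClock t r).nextTime inp) (fun e =>
        if (x.withClock t r).Starts π inp k e then ENNReal.ofReal (tx (e, x.count e))
        else r' e) := by
  have hT := State.nextTime_renewed (x := x) (inp := inp) (t := t) (r := r) (r' := r')
  have hC := State.completes_renewed (x := x) (inp := inp) (t := t) (r := r) hr' hM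
  have hfr := State.nextTime_withClock x inp t r
  set z := x.withClock t r with hz
  set z' := x.renewed (ringing (fun e => x.serve e ≠ none) t (x.deadline inp) r)
      (firstRing (fun e => x.serve e ≠ none) t (x.deadline inp) r)
      (fun e => firstRing (fun e => x.serve e ≠ none) t (x.deadline inp) r + r' e) with hz'
  have hR : z'.nextRecv inp = z.nextRecv inp :=
    State.nextRecv_congr (x := z) (f := z'.finish) hT hC
  have hO : z'.nextObs inp = z.nextObs inp := State.nextObs_congr (x := z) (f := z'.finish) hT hC
  have hH : z'.nextHist inp k = z.nextHist inp k := by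
    simp only [State.nextHist, hO]; rfl
  have hS : z'.nextServe π inp k = z.nextServe π inp k := by
    funext e; simp only [State.nextServe, hH]
  have hQ : z'.nextQueue π inp k = z.nextQueue π inp k := by
    funext e; simp only [State.nextQueue, hH]
  -- Only transmissions that start read `tx`; all quantities below are determined before that, so
  -- the equalities hold by definition.
  have hT' : z'.nextTime (inp.withTx tx) = z.nextTime inp := hT
  have hR' : z'.nextRecv (inp.withTx tx) = z.nextRecv inp := hR
  have hO' : z'.nextObs (inp.withTx tx) = z.nextObs inp := hO
  have hH' : z'.nextHist (inp.withTx tx) k = z.nextHist inp k := hH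
  have hS' : z'.nextServe π (inp.withTx tx) k = z.nextServe π inp k := hS
  have hQ' : z'.nextQueue π (inp.withTx tx) k = z.nextQueue π inp k := hQ
  have hcount : z'.count = z.count := rfl
  have hfin : ∀ e, (z'.next π (inp.withTx tx) k).finish e =
      ((z.next π inp k).withClock (z.nextTime inp) (fun e =>
        if z.Starts π inp k e then ENNReal.ofReal (tx (e, x.count e)) else r' e)).finish e := by
    intro e
    simp only [State.next, hT', hO', hS', hcount]
    by_cases h1 : z.nextServe π inp k e = none
    · rw [if_pos h1]
      exact (State.finish_withClock_of_none h1 _ _).symm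
    · refine Eq.trans ?_ (State.finish_withClock_of_ne h1 _ _).symm
      rw [if_neg h1]
      by_cases h2 : z.nextServe π inp k e = (z.nextObs inp).inService e
      · have h3 : (z.nextObs inp).inService e = if z.Completes inp e then none else z.serve e := by
          simp only [State.nextObs]
        by_cases h4 : z.Completes inp e
        · rw [if_pos h4] at h3
          exact absurd (h2.trans h3) h1
        · rw [if_neg h4] at h3
          have h5 : x.serve e ≠ none := fun h => h1 (h2.trans (h3.trans h))
          have h6 : e ∉ ringing (fun e => x.serve e ≠ none) t (x.deadline inp) r :=
            fun h => h4 ((State.completes_withClock x inp t r e).2 h)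
          rw [if_pos h2, if_neg fun h : z.Starts π inp k e => h.2 h2, hz', hfr]
          simp only [State.renewed, if_neg h5, if_neg h6]
      · rw [if_neg h2, if_pos (show z.Starts π inp k e from ⟨h1, h2⟩)]
        rfl
  have hfin' := funext hfin
  simp only [State.next, State.withClock, hT', hR', hO', hH', hS', hQ', hcount,
    State.mk.injEq, true_and, and_true] at hfin' ⊢
  exact ⟨hfin', rfl⟩

/-- Induction on the number of epochs. At an epoch, `Memoryless.renewal` redraws the residual times
of the transmissions that go on, and `lintegral_resample_tx` turns the durations of the
transmissions that start into clocks. The clock vector after the epoch is then again independent of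
all that precedes, and the induction hypothesis applies to the new state. -/
theorem lintegral_runValue (hw : Measurable fun z : (ℕ → ℝ≥0) × (ℕ → Obs G) => w.score z.1 z.2)
    (inp : Input G R) (n k : ℕ) (x : State G) (t : ℝ≥0∞) (ht : t ≤ x.deadline inp) :
    ∫⁻ r, ∫⁻ tx, runValue w π (inp.withTx tx) n k (x.withClock t r) ∂txLaw G ∂clockLaw G =
      freshValue w π inp n k x t := by
  induction n generalizing k x t with
  | zero => simp [runValue, freshValue]
  | succ n ih =>
    have htx := measurable_withTx inp
    rw [freshValue]
    -- Past the horizon both sides equal the score of the current history. Removing this case makes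
    -- `t` finite, as the renewal theorem demands.
    by_cases hTt : (w.horizon : ℝ≥0∞) < t
    · refine lintegral_congr fun r => ?_
      have hlt : (w.horizon : ℝ≥0∞) < (x.withClock t r).nextTime inp := by
        rw [State.nextTime_withClock]
        exact hTt.trans_le (le_firstRing ht r)
      rw [stepValue_of_lt hlt]
      have : ∀ tx, runValue w π (inp.withTx tx) (n + 1) k (x.withClock t r) =
          w.score inp.gen (x.withClock t r).hist := fun tx =>
        stepValue_of_lt (inp := inp.withTx tx) hlt
      simp [this]
    have ht' : t ≠ ⊤ := fun h => hTt (h ▸ ENNReal.coe_lt_top)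
    have hren := Memoryless.renewal (η := fun e : G.Link => expClock (G.rate e))
      (fun e => memoryless_expClock (G.rate_pos e)) (D := fun e => x.serve e ≠ none) ht ht'
      (F := fun m C f => ∫⁻ tx, runValue w π (inp.withTx tx) (n + 1) k (x.renewed C m f) ∂txLaw G)
      (fun C => by
        refine Measurable.lintegral_prod_right' (f := fun z : (ℝ≥0∞ × (G.Link → ℝ≥0∞)) ×
          (G.Link × ℕ → ℝ) => runValue w π (inp.withTx z.2) (n + 1) k
            (x.renewed C z.1.1 z.1.2)) ?_
        exact measurable_runValue hw (measurable_renewed x C (by fun_prop) (by fun_prop))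
          (htx.comp measurable_snd) _ _)
      (fun m C f g hfg => by
        have : x.renewed C m f = x.renewed C m g := by
          simp only [State.renewed, State.mk.injEq, true_and, and_true]
          funext e
          split_ifs with h1 h2
          · rfl
          · rfl
          · exact hfg e h1 h2
        simp only [this])
    simp only [State.renewed_ringing] at hren
    rw [clockLaw, hren, ← clockLaw]
    refine lintegral_congr fun r => ?_
    have hnt := fun r' => State.nextTime_renewed (x := x) (inp := inp) (t := t) (r := r) (r' := r')
    by_cases hTM : (w.horizon : ℝ≥0∞) < (x.withClock t r).nextTime inp
    · rw [stepValue_of_lt hTM]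
      have : ∀ (r' : G.Link → ℝ≥0∞) tx, runValue w π (inp.withTx tx) (n + 1) k
          (x.renewed (ringing (fun e => x.serve e ≠ none) t (x.deadline inp) r)
            (firstRing (fun e => x.serve e ≠ none) t (x.deadline inp) r)
            (fun e => firstRing (fun e => x.serve e ≠ none) t (x.deadline inp) r + r' e)) =
          w.score inp.gen (x.withClock t r).hist := fun r' tx =>
        stepValue_of_lt (inp := inp.withTx tx) (by rw [← hnt r'] at hTM; exact hTM)
      simp only [this]
      simp
    have hM : (x.withClock t r).nextTime inp ≠ ⊤ := fun h => hTM (h ▸ ENNReal.coe_lt_top)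
    have hstep : ∀ᵐ r' ∂clockLaw G, ∫⁻ tx, runValue w π (inp.withTx tx) (n + 1) k
          (x.renewed (ringing (fun e => x.serve e ≠ none) t (x.deadline inp) r)
            (firstRing (fun e => x.serve e ≠ none) t (x.deadline inp) r)
            (fun e => firstRing (fun e => x.serve e ≠ none) t (x.deadline inp) r + r' e))
            ∂txLaw G =
        if (x.withClock t r).Sound w.lg π inp k then
          ∫⁻ tx, runValue w π (inp.withTx tx) n (k + 1)
            (((x.withClock t r).next π inp k).withClock ((x.withClock t r).nextTime inp) (fun e =>
              if (x.withClock t r).Starts π inp k e then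
                  ENNReal.ofReal (tx (e, x.count e)) else r' e)) ∂txLaw G
        else w.other := by
      filter_upwards [clockLaw_ae_pos] with r' hr'
      have hC := State.completes_renewed (x := x) (inp := inp) (t := t) (r := r) hr' hM
      have hsound := State.sound_congr (x := x.withClock t r) (π := π) (k := k) w.lg
        (hnt r') hC
      have : ∀ tx, runValue w π (inp.withTx tx) (n + 1) k
          (x.renewed (ringing (fun e => x.serve e ≠ none) t (x.deadline inp) r)
            (firstRing (fun e => x.serve e ≠ none) t (x.deadline inp) r)
            (fun e => firstRing (fun e => x.serve e ≠ none) t (x.deadline inp) r + r' e)) =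
          if (x.withClock t r).Sound w.lg π inp k then
            runValue w π (inp.withTx tx) n (k + 1)
              (((x.withClock t r).next π inp k).withClock ((x.withClock t r).nextTime inp)
                (fun e => if (x.withClock t r).Starts π inp k e then
                    ENNReal.ofReal (tx (e, x.count e)) else r' e))
          else w.other := by
        intro tx
        rw [← State.next_renewed hr' hM k tx]
        have h1 : ¬ ((w.horizon : ℝ≥0∞) < State.nextTime (x.renewed
            (ringing (fun e => x.serve e ≠ none) t (x.deadline inp) r)
            (firstRing (fun e => x.serve e ≠ none) t (x.deadline inp) r)
            (fun e => firstRing (fun e => x.serve e ≠ none) t (x.deadline inp) r + r' e))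
            (inp.withTx tx)) := by
          rw [← hnt r'] at hTM; exact hTM
        rw [runValue, stepValue, if_neg h1]
        exact ite_congr (propext hsound) (fun _ => rfl) fun _ => rfl
      simp only [this]
      split_ifs
      · rfl
      · simp
    rw [lintegral_congr_ae hstep, stepValue, if_neg hTM]
    by_cases hs : (x.withClock t r).Sound w.lg π inp k
    · simp only [if_pos hs]
      have hdl : ((x.withClock t r).next π inp k).time ≤
          ((x.withClock t r).next π inp k).deadline inp := by
        refine le_min (le_iInf fun l => le_iInf fun h => h.le) ?_
        simp only [State.next]
        exact le_self_add
      rw [← ih (k + 1) _ _ hdl]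
      refine lintegral_resample_tx (Ψ := fun s tx => runValue w π (inp.withTx tx) n (k + 1)
        (((x.withClock t r).next π inp k).withClock ((x.withClock t r).nextTime inp) s)) ?_
        x.count ((x.withClock t r).Starts π inp k) ?_
      · exact measurable_runValue hw (measurable_withClock measurable_const measurable_const
          measurable_fst) (htx.comp measurable_snd) _ _
      · intro s tx tx' h
        -- A link that starts a transmission increases its count, so the entry just turned into a
        -- clock lies below the new count.
        refine runValue_congr_tx n (k + 1) fun e i hi => h e i fun hp => ?_
        have : ((x.withClock t r).next π inp k).count e = x.count e + 1 := by
          simp only [State.next]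
          rw [if_neg]
          · rfl
          · exact fun h => h.elim hp.1 hp.2
        have hi' : ((x.withClock t r).next π inp k).count e ≤ i := hi
        omega
    · simp only [if_neg hs]
      simp

end Bridge

/-! ### Interrupting the memoryless run at the epochs of another run -/

section Advance

open Classical

variable {G : Network} {R : Type*}

lemma State.withClock_zero (x : State G) (t : ℝ≥0∞) (r : G.Link → ℝ≥0∞) :
    x.withClock 0 (fun e => t + r e) = x.withClock t r := by
  simp only [State.withClock, zero_add]

variable [MeasurableSpace R] {w : Valuation G R} {π : Policy G R}

/-- The memoryless run can be restarted at the next epoch of another run, if this epoch comes before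
its own next epoch. -/
theorem freshValue_advance
    (hw : Measurable fun z : (ℕ → ℝ≥0) × (ℕ → Obs G) => w.score z.1 z.2)
    (inp : Input G R) (n k : ℕ) (x y : State G) {t : ℝ≥0∞} (hx : t ≤ x.deadline inp)
    (hy : t ≤ y.deadline inp) :
    freshValue w π inp (n + 1) k x t =
      ∫⁻ r, (if (y.withClock t r).nextTime inp < (x.withClock t r).nextTime inp then
          freshValue w π inp (n + 1) k x ((y.withClock t r).nextTime inp)
        else stepValue w π (fun y => freshValue w π inp n (k + 1) y y.time) inp k
          (x.withClock t r)) ∂clockLaw G := by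
  set V : State G → ℝ≥0∞ := fun y => freshValue w π inp n (k + 1) y y.time with hV
  have hle : ∀ (z : State G), t ≤ z.deadline inp → ∀ r, t ≤ (z.withClock t r).nextTime inp := by
    intro z hz r
    rw [State.nextTime_withClock]
    exact le_firstRing hz r
  -- At `t = ⊤` both next epochs are `⊤`, so neither comes strictly first.
  by_cases ht : t = ⊤
  · rw [freshValue]
    refine lintegral_congr fun r => ?_
    have h1 := hle x hx r
    have h2 := hle y hy r
    rw [ht, top_le_iff] at h1 h2
    rw [if_neg]
    rw [← ht] at h1 h2
    rw [h1, h2]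
    exact lt_irrefl _
  have hmV : ∀ {α : Type _} [MeasurableSpace α] {f : α → State G}, Measurable f →
      Measurable fun a => stepValue w π V inp k (f a) := by
    intro α _ f hf
    refine measurable_stepValue hw hf measurable_const (V := fun _ => V) k ?_
    have hn := State.measurable_next (g := fun _ => inp) π hf measurable_const k
    exact measurable_freshValue hw hn measurable_const (State.measurable_time.comp hn) n (k + 1)
  -- All links busy in at least one of the two runs, capped by the smaller deadline: the first ring
  -- is then the earlier of the two next epochs.
  set D : G.Link → Prop := fun e => x.serve e ≠ none ∨ y.serve e ≠ none with hD
  set c := min (x.deadline inp) (y.deadline inp) with hc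
  have hJ : ∀ r, firstRing D t c r =
      min ((x.withClock t r).nextTime inp) ((y.withClock t r).nextTime inp) := by
    intro r
    rw [State.nextTime_withClock, State.nextTime_withClock]
    refine le_antisymm (le_min (le_firstRing_iff.2 ⟨fun i hi => ?_, ?_⟩)
      (le_firstRing_iff.2 ⟨fun i hi => ?_, ?_⟩)) (le_firstRing_iff.2 ⟨fun i hi => ?_, ?_⟩)
    · exact firstRing_le_of_mem (D := D) r (Or.inl hi)
    · exact (firstRing_le r).trans (min_le_left _ _)
    · exact firstRing_le_of_mem (D := D) r (Or.inr hi)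
    · exact (firstRing_le r).trans (min_le_right _ _)
    · rcases hi with hi | hi
      · exact (min_le_left _ _).trans
          (firstRing_le_of_mem (D := fun e => x.serve e ≠ none) r hi)
      · exact (min_le_right _ _).trans
          (firstRing_le_of_mem (D := fun e => y.serve e ≠ none) r hi)
    · exact min_le_min (firstRing_le r) (firstRing_le r)
  -- Whether the run of `x` is due at the merged epoch must be decided from its time and ringing set
  -- alone, since `F` below may depend on the ringing clocks through these only.
  have hN : ∀ r, (x.deadline inp ≤ firstRing D t c r ∨
      ∃ e ∈ ringing D t c r, x.serve e ≠ none) ↔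
      ¬ (y.withClock t r).nextTime inp < (x.withClock t r).nextTime inp := by
    intro r
    have hxr := State.nextTime_withClock x inp t r
    constructor
    · intro h hlt
      have hJy : firstRing D t c r = (y.withClock t r).nextTime inp := by
        rw [hJ, min_eq_right hlt.le]
      rcases h with h | ⟨e, he, hex⟩
      · rw [hJy] at h
        exact absurd (h.trans_lt hlt) (not_lt.2 (hxr ▸ firstRing_le r))
      · have h1 := (mem_ringing.1 he).2
        rw [hJy] at h1
        exact absurd (h1.trans_lt hlt)
          (not_lt.2 (hxr ▸ firstRing_le_of_mem (D := fun e => x.serve e ≠ none) r hex))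
    · intro h
      have hJx : firstRing D t c r = (x.withClock t r).nextTime inp := by
        rw [hJ, min_eq_left (not_lt.1 h)]
      rcases firstRing_eq_or (D := fun e => x.serve e ≠ none) (t := t) (c := x.deadline inp) r with
        h' | ⟨e, he, h'⟩
      · left
        rw [hJx, hxr, h']
      · right
        exact ⟨e, mem_ringing.2 ⟨Or.inl he, by rw [hJx, hxr, h']⟩, he⟩
  -- Renewal is used only where `y` comes strictly first: there no busy link of `x` rings, so all
  -- residual times of `x` are redrawn. Elsewhere `F` vanishes and the integrand is kept.
  have hren := Memoryless.renewal (η := fun e : G.Link => expClock (G.rate e))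
    (fun e => memoryless_expClock (G.rate_pos e)) (D := D) (t := t) (c := c) (le_min hx hy) ht
    (F := fun m C f => if (x.deadline inp ≤ m ∨ ∃ e ∈ C, x.serve e ≠ none) then 0
      else stepValue w π V inp k (x.withClock 0 f))
    (fun C => by
      refine Measurable.ite ?_ measurable_const (hmV (measurable_withClock measurable_const
        measurable_const measurable_snd))
      exact (measurableSet_le measurable_const measurable_fst).union (.const _))
    (fun m C f g hfg => by
      refine ite_congr rfl (fun _ => rfl) fun h => ?_
      push Not at h
      have : x.withClock 0 f = x.withClock 0 g := by
        simp only [State.withClock, State.mk.injEq, true_and, and_true]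
        funext e
        split_ifs with h1
        · rfl
        · rw [hfg e (Or.inl h1) fun he => h1 (h.2 e he)]
      rw [this])
  simp only [hN, State.withClock_zero] at hren
  have hmx : Measurable fun r => (x.withClock t r).nextTime inp :=
    State.measurable_nextTime (measurable_withClock measurable_const measurable_const measurable_id)
      measurable_const
  have hmy : Measurable fun r => (y.withClock t r).nextTime inp :=
    State.measurable_nextTime (measurable_withClock measurable_const measurable_const measurable_id)
      measurable_const
  have hset : MeasurableSet {r | ¬ (y.withClock t r).nextTime inp < (x.withClock t r).nextTime inp} :=
    (measurableSet_lt hmy hmx).compl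
  have hstep : Measurable fun r => stepValue w π V inp k (x.withClock t r) :=
    hmV (measurable_withClock measurable_const measurable_const measurable_id)
  have hB : Measurable fun r =>
      if ¬ (y.withClock t r).nextTime inp < (x.withClock t r).nextTime inp then
        stepValue w π V inp k (x.withClock t r) else 0 :=
    Measurable.ite hset hstep measurable_const
  calc freshValue w π inp (n + 1) k x t
      = ∫⁻ r, ((if ¬ (y.withClock t r).nextTime inp < (x.withClock t r).nextTime inp then
          stepValue w π V inp k (x.withClock t r) else 0) +
          if ¬ (y.withClock t r).nextTime inp < (x.withClock t r).nextTime inp then 0 else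
            stepValue w π V inp k (x.withClock t r)) ∂clockLaw G := by
        rw [freshValue]
        refine lintegral_congr fun r => ?_
        split_ifs <;> simp [hV]
    _ = _ := by
        rw [lintegral_add_left hB, clockLaw, hren, ← clockLaw, ← lintegral_add_left hB]
        refine lintegral_congr fun r => ?_
        by_cases h : (y.withClock t r).nextTime inp < (x.withClock t r).nextTime inp
        · simp only [h, not_true, if_false, if_true, zero_add]
          rw [hJ, min_eq_right h.le]
          rfl
        · simp [h]

end Advance

/-! ### The coupling of a preemptive LGFS policy with another policy -/

section Coupling

variable {G : Network} {R : Type*}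

/-- The properties of a state `x` that follows epoch `k - 1`, with no further epoch before `t`. -/
structure State.Consistent (inp : Input G R) (k : ℕ) (x : State G) (t : ℝ≥0∞) : Prop where
  time_le : x.time ≤ t
  le_deadline : t ≤ x.deadline inp
  arrived : (∀ l, inp.arr l ≤ x.time → l ∈ x.recv 0) ∨ x.review ≤ x.time
  recv_hist : ∀ j l, l ∈ x.recv j → ∃ i, l ∈ (x.hist i).recv j ∧ (x.hist i).time ≤ x.time
  arr_le : ∀ i j l, l ∈ (x.hist i).recv j → inp.arr l ≤ (x.hist i).time
  hist_blank : ∀ i, k ≤ i → ∀ j, (x.hist i).recv j = ∅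
  serve_mem : ∀ e l, x.serve e = some l → l ∈ x.recv (G.src e)
  queue_subset : ∀ e, x.queue e ⊆ x.recv (G.src e)

/-- Each link either sends a packet that is as fresh as all packets of its origin, or its
destination has such a packet. -/
def State.Greedy (inp : Input G R) (x : State G) : Prop :=
  ∀ e, (∀ l ∈ x.recv (G.src e), ∃ l' ∈ x.recv (G.dst e), inp.gen l ≤ inp.gen l') ∨
    ∃ l, x.serve e = some l ∧ ∀ l' ∈ x.recv (G.src e), inp.gen l' ≤ inp.gen l

/-- In the state `x`, all nodes have received packets that are at least as fresh as in the state
`y`, and have received them at least as early. -/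
structure State.Dominates (inp : Input G R) (x y : State G) : Prop where
  recv : ∀ j, ∀ l ∈ y.recv j, ∃ l' ∈ x.recv j, inp.gen l ≤ inp.gen l'
  hist : ∀ i j, ∀ l ∈ (y.hist i).recv j, ∃ i', ∃ l' ∈ (x.hist i').recv j,
    (x.hist i').time ≤ (y.hist i).time ∧ inp.gen l ≤ inp.gen l'

variable {inp : Input G R} {k k' : ℕ} {x y : State G} {t : ℝ≥0∞} {r : G.Link → ℝ≥0∞}

lemma State.Consistent.advance (h : x.Consistent inp k t) {t' : ℝ≥0∞} (h1 : t ≤ t')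
    (h2 : t' ≤ x.deadline inp) : x.Consistent inp k t' :=
  { h with time_le := h.time_le.trans h1, le_deadline := h2 }

lemma State.Consistent.le_nextTime (h : x.Consistent inp k t) (r : G.Link → ℝ≥0∞) :
    t ≤ (x.withClock t r).nextTime inp := by
  rw [State.nextTime_withClock]
  exact le_firstRing h.le_deadline r

lemma State.nextTime_le_deadline (x : State G) (inp : Input G R) (t : ℝ≥0∞)
    (r : G.Link → ℝ≥0∞) : (x.withClock t r).nextTime inp ≤ x.deadline inp := by
  rw [State.nextTime_withClock]
  exact firstRing_le r

/-- The heart of the coupling. A packet delivered in `y` over `e` is no fresher than some packet `x`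
has at the origin of `e`. By `State.Greedy`, either the destination in `x` already holds one as
fresh, or `x` is sending one over `e`; the clock of `e` is common, so that transmission ends at the
same instant. -/
lemma State.Dominates.exists_le_of_mem_nextRecv (h : x.Dominates inp y) (hg : x.Greedy inp)
    (hx : x.Consistent inp k t) (hy : y.Consistent inp k' t)
    (hle : (y.withClock t r).nextTime inp ≤ (x.withClock t r).nextTime inp) (j : G.Node) (l : ℕ)
    (hl : l ∈ (y.withClock t r).nextRecv inp j) :
    ∃ l', inp.gen l ≤ inp.gen l' ∧ (l' ∈ x.recv j ∨
      (x.withClock t r).nextTime inp ≤ (y.withClock t r).nextTime inp ∧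
        l' ∈ (x.withClock t r).nextRecv inp j) := by
  rcases hl with (hl | ⟨e, rfl, hc, hl⟩) | ⟨rfl, hl⟩
  · obtain ⟨l', hl', hle'⟩ := h.recv j l hl
    exact ⟨l', hle', Or.inl hl'⟩
  · obtain ⟨l', hl', hle'⟩ := h.recv _ l (hy.serve_mem e l hl)
    rcases hg e with hg | ⟨m, hm, hg⟩
    · obtain ⟨b, hb, hlb⟩ := hg l' hl'
      exact ⟨b, hle'.trans hlb, Or.inl hb⟩
    · refine ⟨m, hle'.trans (hg l' hl'), Or.inr ?_⟩
      have hfin : t + r e ≤ (y.withClock t r).nextTime inp := by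
        have hye : y.serve e ≠ none := by
          have : y.serve e = some l := hl
          simp [this]
        have := hc.2
        simpa only [State.withClock, if_neg hye] using this
      have hxe : x.serve e ≠ none := by simp [hm]
      have hxfin : (x.withClock t r).finish e = t + r e := if_neg hxe
      refine ⟨?_, Or.inl (Or.inr ⟨e, rfl, ⟨hxe, ?_⟩, hm⟩)⟩
      · exact ((min_le_left _ _).trans (iInf_le _ e)).trans (hxfin.le.trans hfin)
      · exact hxfin.le.trans (hfin.trans hle)
  · refine ⟨l, le_rfl, ?_⟩
    by_cases hlt : (x.withClock t r).nextTime inp ≤ (y.withClock t r).nextTime inp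
    · exact Or.inr ⟨hlt, Or.inr ⟨rfl, hl.trans hle⟩⟩
    · left
      have hdl := State.nextTime_le_deadline x inp t r
      have hlt' := (not_le.1 hlt).trans_le hdl
      -- An arrival unknown to `x` would be a deadline for `x` no later than the epoch of `y`. The
      -- second alternative serves the initial state, where arrivals at time 0 are not yet received
      -- but a review is due at once.
      rcases hx.arrived with ha | ha
      · by_cases hlx : inp.arr l ≤ x.time
        · exact ha l hlx
        · exfalso
          refine absurd hl (not_le.2 (hlt'.trans_le ?_))
          exact (min_le_left _ _).trans ((iInf_le _ l).trans (iInf_le _ (not_le.1 hlx)))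
      · exfalso
        refine absurd (ha.trans (hx.time_le.trans (hy.le_nextTime r))) (not_le.2 (hlt'.trans_le ?_))
        exact min_le_right _ _

variable [MeasurableSpace R] {π P : Policy G R} {lg : Prop}

lemma State.hist_next_self (x : State G) : (x.next π inp k).hist k = x.nextObs inp := by
  simp [State.next, State.nextHist]

lemma State.hist_next_of_ne (x : State G) {i : ℕ} (h : i ≠ k) :
    (x.next π inp k).hist i = x.hist i := by
  simp [State.next, State.nextHist, h]

lemma State.Consistent.next (h : x.Consistent inp k t)
    (hs : (x.withClock t r).Sound lg π inp k) :
    ((x.withClock t r).next π inp k).Consistent inp (k + 1)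
      ((x.withClock t r).nextTime inp) := by
  have htM := h.le_nextTime r
  have havail : ∀ e, ((x.withClock t r).nextObs inp).avail e ⊆
      (x.withClock t r).nextRecv inp (G.src e) := by
    rintro e l ((hl | ⟨-, hl⟩) | hl)
    · exact Or.inl (Or.inl (h.queue_subset e hl))
    · exact Or.inl (Or.inl (h.serve_mem e l hl))
    · exact hl.1
  have harr : ∀ j, ∀ l ∈ x.recv j, inp.arr l ≤ (x.withClock t r).nextTime inp := by
    intro j l hl
    obtain ⟨i, hi, hi'⟩ := h.recv_hist j l hl
    exact (h.arr_le i j l hi).trans (hi'.trans (h.time_le.trans htM))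
  refine ⟨le_rfl, ?_, Or.inl fun l hl => ?_, fun j l hl => ⟨k, ?_⟩, fun i j l hl => ?_,
    fun i hi j => ?_, fun e l hl => ?_, fun e => ?_⟩
  · refine le_min (le_iInf fun l => le_iInf fun hl => le_of_lt hl) ?_
    simp only [State.next]
    exact le_self_add
  · exact Or.inr ⟨rfl, hl⟩
  · rw [State.hist_next_self]
    exact ⟨hl, le_rfl⟩
  · by_cases hi : i = k
    · subst hi
      rw [State.hist_next_self] at hl ⊢
      rcases hl with (hl | ⟨e, -, -, hl⟩) | hl
      · exact harr j l hl
      · exact harr _ l (h.serve_mem e l hl)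
      · exact hl.2
    · rw [State.hist_next_of_ne _ hi] at hl ⊢
      exact h.arr_le i j l hl
  · rw [State.hist_next_of_ne _ (by omega)]
    exact h.hist_blank i (by omega) j
  · exact havail e ((hs e).1 l hl)
  · exact (hs e).2.1.trans (havail e)

/-- The invariant concerns only the packet in service, so the contents of the queues cannot disturb
it. A packet at the origin that is fresher than the one chosen is not available; by the previous
invariant the destination must make up for it. -/
lemma State.Greedy.next (hg : x.Greedy inp)
    (hs : (x.withClock t r).Sound True P inp k) :
    ((x.withClock t r).next P inp k).Greedy inp := by
  intro e
  set z := x.withClock t r with hz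
  have hnew : ∀ l ∈ z.nextRecv inp (G.src e), l ∈ x.recv (G.src e) ∨ l ∈ (z.nextObs inp).avail e :=
    fun l hl => or_iff_not_imp_left.2 fun h => Or.inr ⟨hl, h⟩
  -- The invariant just before the decision: a completed transmission has passed its packet to the
  -- destination, any other leaves it available.
  have hold : (∀ l ∈ x.recv (G.src e), ∃ l' ∈ z.nextRecv inp (G.dst e), inp.gen l ≤ inp.gen l') ∨
      ∃ l ∈ (z.nextObs inp).avail e, ∀ l' ∈ x.recv (G.src e), inp.gen l' ≤ inp.gen l := by
    rcases hg e with h | ⟨l, hl, h⟩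
    · left
      intro l hl
      obtain ⟨l', hl', hle⟩ := h l hl
      exact ⟨l', Or.inl (Or.inl hl'), hle⟩
    · by_cases hc : z.Completes inp e
      · left
        exact fun l' hl' => ⟨l, Or.inl (Or.inr ⟨e, rfl, hc, hl⟩), h l' hl'⟩
      · right
        exact ⟨l, Or.inl (Or.inr ⟨hc, hl⟩), h⟩
  change (∀ l ∈ z.nextRecv inp (G.src e), ∃ l' ∈ z.nextRecv inp (G.dst e),
    inp.gen l ≤ inp.gen l') ∨ ∃ l, z.nextServe P inp k e = some l ∧
      ∀ l' ∈ z.nextRecv inp (G.src e), inp.gen l' ≤ inp.gen l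
  by_cases hne : ((z.nextObs inp).avail e).Nonempty
  · obtain ⟨m, hm, hmax⟩ := (hs e).2.2 trivial hne
    by_cases hall : ∀ l' ∈ z.nextRecv inp (G.src e), inp.gen l' ≤ inp.gen m
    · exact Or.inr ⟨m, hm, hall⟩
    · push Not at hall
      obtain ⟨a, ha, hma⟩ := hall
      -- `a` is fresher than every available packet, hence received earlier, and an available packet
      -- cannot be what satisfied the invariant for it.
      have haold : a ∈ x.recv (G.src e) :=
        (hnew a ha).resolve_right fun h => absurd (hmax a h) (not_le.2 hma)
      rcases hold with hold | ⟨l, hl, hold⟩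
      · left
        intro b hb
        rcases hnew b hb with hb | hb
        · exact hold b hb
        · obtain ⟨c, hc, hac⟩ := hold a haold
          exact ⟨c, hc, (hmax b hb).trans (hma.le.trans hac)⟩
      · exact absurd ((hold a haold).trans (hmax l hl)) (not_le.2 hma)
  · rw [Set.not_nonempty_iff_eq_empty] at hne
    rw [hne] at hold hnew
    left
    rcases hold with hold | ⟨l, hl, -⟩
    · exact fun l hl => hold l ((hnew l hl).resolve_right fun h => h.elim)
    · exact hl.elim

lemma State.Consistent.hist_next (hx : x.Consistent inp k t) {i : ℕ} {j : G.Node} {l : ℕ}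
    (hl : l ∈ (x.hist i).recv j) : ((x.withClock t r).next P inp k).hist i = x.hist i := by
  refine State.hist_next_of_ne _ fun hi => ?_
  rw [hx.hist_blank i hi.ge j] at hl
  exact hl

lemma State.Dominates.next_left (h : x.Dominates inp y) (hx : x.Consistent inp k t) :
    ((x.withClock t r).next P inp k).Dominates inp y := by
  refine ⟨fun j l hl => ?_, fun i j l hl => ?_⟩
  · obtain ⟨l', hl', hle⟩ := h.recv j l hl
    exact ⟨l', Or.inl (Or.inl hl'), hle⟩
  · obtain ⟨i', l', hl', hle⟩ := h.hist i j l hl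
    refine ⟨i', l', ?_⟩
    rw [hx.hist_next hl']
    exact ⟨hl', hle⟩

/-- As `x` has no epoch yet, everything `y` has just received must be matched by packets already in
`x`, whose recorded receipts are no later than this epoch. -/
lemma State.Dominates.next_right (h : x.Dominates inp y) (hg : x.Greedy inp)
    (hx : x.Consistent inp k t) (hy : y.Consistent inp k' t)
    (hlt : (y.withClock t r).nextTime inp < (x.withClock t r).nextTime inp) :
    x.Dominates inp ((y.withClock t r).next π inp k') := by
  have hrecv := fun j l hl => h.exists_le_of_mem_nextRecv hg hx hy hlt.le j l hl
  have hrecv' : ∀ j, ∀ l ∈ (y.withClock t r).nextRecv inp j, ∃ l' ∈ x.recv j,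
      inp.gen l ≤ inp.gen l' := by
    intro j l hl
    obtain ⟨l', hle, hl' | ⟨hc, -⟩⟩ := hrecv j l hl
    · exact ⟨l', hl', hle⟩
    · exact absurd hlt (not_lt.2 hc)
  refine ⟨hrecv', fun i j l hl => ?_⟩
  by_cases hi : i = k'
  · subst hi
    rw [State.hist_next_self] at hl ⊢
    obtain ⟨l', hl', hle⟩ := hrecv' j l hl
    obtain ⟨i', hi', ht'⟩ := hx.recv_hist j l' hl'
    exact ⟨i', l', hi', ht'.trans (hx.time_le.trans (hy.le_nextTime r)), hle⟩
  · rw [State.hist_next_of_ne _ hi] at hl ⊢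
    exact h.hist i j l hl

lemma State.Dominates.next_both (h : x.Dominates inp y) (hg : x.Greedy inp)
    (hx : x.Consistent inp k t) (hy : y.Consistent inp k' t)
    (heq : (y.withClock t r).nextTime inp = (x.withClock t r).nextTime inp) :
    ((x.withClock t r).next P inp k).Dominates inp ((y.withClock t r).next π inp k') := by
  have hrecv : ∀ j, ∀ l ∈ (y.withClock t r).nextRecv inp j,
      ∃ l' ∈ (x.withClock t r).nextRecv inp j, inp.gen l ≤ inp.gen l' := by
    intro j l hl
    obtain ⟨l', hle, hl' | ⟨-, hl'⟩⟩ := h.exists_le_of_mem_nextRecv hg hx hy heq.le j l hl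
    · exact ⟨l', Or.inl (Or.inl hl'), hle⟩
    · exact ⟨l', hl', hle⟩
  refine ⟨hrecv, fun i j l hl => ?_⟩
  by_cases hi : i = k'
  · subst hi
    rw [State.hist_next_self] at hl ⊢
    obtain ⟨l', hl', hle⟩ := hrecv j l hl
    refine ⟨k, l', ?_⟩
    rw [State.hist_next_self]
    exact ⟨hl', heq.ge, hle⟩
  · rw [State.hist_next_of_ne _ hi] at hl ⊢
    exact (h.next_left hx).hist i j l hl

variable {w v : Valuation G R}

lemma freshValue_of_lt (n k : ℕ) (hx : t ≤ x.deadline inp) (ht : (w.horizon : ℝ≥0∞) < t) :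
    freshValue w π inp (n + 1) k x t = w.score inp.gen x.hist := by
  rw [freshValue]
  have : ∀ r, stepValue w π (fun y => freshValue w π inp n (k + 1) y y.time) inp k
      (x.withClock t r) = w.score inp.gen x.hist := fun r => stepValue_of_lt (by
    rw [State.nextTime_withClock]
    exact ht.trans_le (le_firstRing hx r))
  simp [this]

lemma freshValue_le_one (hs : ∀ s h, w.score s h ≤ 1) (ho : w.other ≤ 1) (n k : ℕ)
    (x : State G) (t : ℝ≥0∞) : freshValue w π inp n k x t ≤ 1 := by
  induction n generalizing k x t with
  | zero => exact ho
  | succ n ih =>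
    rw [freshValue]
    calc _ ≤ ∫⁻ _, 1 ∂clockLaw G := lintegral_mono fun r => by
            unfold stepValue
            split_ifs
            · exact hs _ _
            · exact ih _ _ _
            · exact ho
      _ = 1 := by simp

/-- The memoryless run of a preemptive LGFS policy is worth at most as much as the memoryless run of
any other policy, if dominated histories are worth more, and incomplete runs are worth least for the
former and most for the latter. -/
theorem freshValue_le_freshValue
    (hw : Measurable fun z : (ℕ → ℝ≥0) × (ℕ → Obs G) => w.score z.1 z.2)
    (hv : Measurable fun z : (ℕ → ℝ≥0) × (ℕ → Obs G) => v.score z.1 z.2)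
    (hw0 : w.other = 0) (hv1 : v.other = 1) (hwlg : w.lg) (hhor : w.horizon = v.horizon)
    (hw1 : ∀ s h, w.score s h ≤ 1)
    (hscore : ∀ (x y : State G), (∀ i j, ∀ l ∈ (x.hist i).recv j, inp.arr l ≤ (x.hist i).time) →
      x.Dominates inp y → w.score inp.gen x.hist ≤ v.score inp.gen y.hist)
    (N n m : ℕ) (hN : n + m ≤ N) (hx : x.Consistent inp k t) (hy : y.Consistent inp k' t)
    (hg : x.Greedy inp) (hd : x.Dominates inp y) :
    freshValue w P inp n k x t ≤ freshValue v π inp m k' y t := by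
  -- Each merged epoch uses up one unit of `n`, of `m`, or of both, so the induction is on a bound
  -- for the sum.
  induction N generalizing n m k k' x y t with
  | zero =>
    obtain rfl : n = 0 := by omega
    simp [freshValue, hw0]
  | succ N ih =>
    rcases n with _ | n
    · simp [freshValue, hw0]
    rcases m with _ | m
    · rw [show freshValue v π inp 0 k' y t = 1 from hv1]
      exact freshValue_le_one hw1 (by simp [hw0]) _ _ _ _
    -- Both values become integrals over the same clock vector, interrupted at the earlier of the
    -- two epochs. Comparing the integrands pointwise is the coupling.
    rw [freshValue_advance hw inp n k x y hx.le_deadline hy.le_deadline,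
      freshValue_advance hv inp m k' y x hy.le_deadline hx.le_deadline]
    refine lintegral_mono fun r => ?_
    have hlg : w.lg = True := eq_true hwlg
    rcases lt_trichotomy ((y.withClock t r).nextTime inp) ((x.withClock t r).nextTime inp) with
      hlt | heq | hgt
    · simp only [if_pos hlt, if_neg hlt.not_gt]
      have hdx := hlt.le.trans (State.nextTime_le_deadline x inp t r)
      unfold stepValue
      by_cases hT : (v.horizon : ℝ≥0∞) < (y.withClock t r).nextTime inp
      · rw [if_pos hT, freshValue_of_lt _ _ hdx (hhor ▸ hT)]
        exact hscore x y hx.arr_le hd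
      · rw [if_neg hT]
        split_ifs with hs
        · exact ih (n + 1) m (by omega) (hx.advance (hy.le_nextTime r) hdx) (hy.next hs) hg
            (hd.next_right hg hx hy hlt)
        · rw [hv1]
          exact freshValue_le_one hw1 (by simp [hw0]) _ _ _ _
    · simp only [heq, lt_irrefl, if_false]
      unfold stepValue
      rw [heq, hhor]
      by_cases hT : (v.horizon : ℝ≥0∞) < (x.withClock t r).nextTime inp
      · rw [if_pos hT, if_pos hT]
        exact hscore x y hx.arr_le hd
      · rw [if_neg hT, if_neg hT]
        by_cases hsx : (x.withClock t r).Sound w.lg P inp k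
        · rw [if_pos hsx]
          split_ifs with hsy
          · have hyn := hy.next (r := r) hsy
            rw [heq] at hyn
            have hgn := hg.next (hlg ▸ hsx)
            have htime : ((y.withClock t r).next π inp k').time =
              ((x.withClock t r).next P inp k).time := heq
            beta_reduce
            rw [htime]
            exact ih n m (by omega) (hx.next hsx) hyn hgn (hd.next_both hg hx hy heq)
          · rw [hv1]
            exact freshValue_le_one hw1 (by simp [hw0]) _ _ _ _
        · rw [if_neg hsx, hw0]
          exact zero_le
    · simp only [if_pos hgt, if_neg hgt.not_gt]
      have hdy := hgt.le.trans (State.nextTime_le_deadline y inp t r)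
      unfold stepValue
      by_cases hT : (w.horizon : ℝ≥0∞) < (x.withClock t r).nextTime inp
      · rw [if_pos hT, freshValue_of_lt _ _ hdy (hhor ▸ hT)]
        exact hscore x y hx.arr_le hd
      · rw [if_neg hT]
        split_ifs with hs
        · exact ih n (m + 1) (by omega) (hx.next hs) (hy.advance (hx.le_nextTime r) hdy)
            (hg.next (hlg ▸ hs)) (hd.next_left hx)
        · rw [hw0]
          exact zero_le

end Coupling

/-! ### Ages as functions of the history -/

section HistoryAge

variable {G : Network} {R : Type*}

/-- The generation time of the freshest packet received by node `j` up to time `t`, according to the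
history `h`. -/
noncomputable def histFreshest (s : ℕ → ℝ≥0) (h : ℕ → Obs G) (t : ℝ≥0) (j : G.Node) : ℝ≥0 :=
  sSup (insert 0 {u | ∃ l, (∃ i, (h i).time ≤ t ∧ l ∈ (h i).recv j) ∧ u = s l})

open Classical in
/-- The indicator of the event that the ages at the times `τ` belong to `U`. -/
noncomputable def ageScore {m : ℕ} (τ : Fin m → ℝ≥0) (U : Set (Fin m × G.Node → ℝ))
    (s : ℕ → ℝ≥0) (h : ℕ → Obs G) : ℝ≥0∞ :=
  if (fun p => (τ p.1 : ℝ) - (histFreshest s h (τ p.1) p.2 : ℝ)) ∈ U then 1 else 0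

variable {m : ℕ} {τ : Fin m → ℝ≥0} {U : Set (Fin m × G.Node → ℝ)}

lemma measurable_ageScore (hU : MeasurableSet U) :
    Measurable fun z : (ℕ → ℝ≥0) × (ℕ → Obs G) => ageScore τ U z.1 z.2 := by
  refine Measurable.ite ?_ measurable_const measurable_const
  refine hU.preimage (measurable_pi_lambda _ fun p => ?_)
  refine Measurable.const_sub (measurable_coe_nnreal_real.comp ?_) _
  refine measurable_sSup_insert_zero (fun l => ?_) fun l => by fun_prop
  refine Measurable.exists fun i => Measurable.and ?_ ?_
  · exact measurableSet_setOfPred.1 (measurableSet_le (by fun_prop) measurable_const)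
  · exact measurable_set_iff.1 (by fun_prop) l

lemma ageScore_le_one (s : ℕ → ℝ≥0) (h : ℕ → Obs G) : ageScore τ U s h ≤ 1 := by
  unfold ageScore
  split_ifs
  · exact le_rfl
  · exact zero_le_one

lemma histFreshest_le_histFreshest {inp : Input G R} {x y : State G}
    (hsa : ∀ l, (inp.gen l : ℝ≥0∞) ≤ inp.arr l)
    (hx : ∀ i j, ∀ l ∈ (x.hist i).recv j, inp.arr l ≤ (x.hist i).time) (h : x.Dominates inp y)
    (t : ℝ≥0) (j : G.Node) :
    histFreshest inp.gen y.hist t j ≤ histFreshest inp.gen x.hist t j := by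
  -- A packet received by time `t` was generated by time `t`. Without this bound the `sSup` could be
  -- a default value and monotonicity would fail.
  have hbdd : BddAbove (insert 0 {u | ∃ l, (∃ i, (x.hist i).time ≤ t ∧ l ∈ (x.hist i).recv j) ∧
      u = inp.gen l}) := by
    refine ⟨t, ?_⟩
    rintro _ (rfl | ⟨l, ⟨i, hi, hl⟩, rfl⟩)
    · exact zero_le
    · exact_mod_cast (hsa l).trans ((hx i j l hl).trans hi)
  refine csSup_le (Set.insert_nonempty _ _) ?_
  rintro _ (rfl | ⟨l, ⟨i, hi, hl⟩, rfl⟩)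
  · exact zero_le
  · obtain ⟨i', l', hl', ht, hle⟩ := h.hist i j l hl
    exact le_csSup_of_le hbdd (Or.inr ⟨l', ⟨i', ht.trans hi, hl'⟩, rfl⟩) hle

lemma ageScore_le_ageScore {inp : Input G R} {x y : State G} (hU : IsUpperSet U)
    (hsa : ∀ l, (inp.gen l : ℝ≥0∞) ≤ inp.arr l)
    (hx : ∀ i j, ∀ l ∈ (x.hist i).recv j, inp.arr l ≤ (x.hist i).time)
    (h : x.Dominates inp y) : ageScore τ U inp.gen x.hist ≤ ageScore τ U inp.gen y.hist := by
  unfold ageScore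
  by_cases hm : (fun p : Fin m × G.Node =>
      (τ p.1 : ℝ) - (histFreshest inp.gen x.hist (τ p.1) p.2 : ℝ)) ∈ U
  · rw [if_pos hm, if_pos]
    refine hU (fun p => ?_) hm
    have := histFreshest_le_histFreshest hsa hx h (τ p.1) p.2
    exact sub_le_sub_left (NNReal.coe_le_coe.2 this) _
  · rw [if_neg hm]
    exact zero_le

lemma consistent_init {inp : Input G R} : (State.init G).Consistent inp 0 0 :=
  ⟨le_rfl, zero_le, Or.inr le_rfl, fun _ _ h => h.elim, fun _ _ _ h => h.elim,
    fun _ _ _ => rfl, fun _ _ h => (Option.some_ne_none _ h.symm).elim, fun _ _ h => h⟩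

end HistoryAge

/-! ### The history of a run -/

section Run

variable {G : Network} {R : Type*} [MeasurableSpace R] (π : Policy G R) (inp : Input G R)

lemma run_time_le (k : ℕ) : (∀ e, (run π inp k).time ≤ (run π inp k).finish e) ∧
    (run π inp k).time ≤ (run π inp k).review := by
  induction k with
  | zero => exact ⟨fun e => le_top, le_rfl⟩
  | succ k ih =>
    refine ⟨fun e => ?_, ?_⟩
    · simp only [run, State.next]
      split_ifs
      · exact le_top
      · exact (min_le_left _ _).trans (iInf_le _ e)
      · exact le_self_add
    · simp only [run, State.next]
      exact le_self_add

lemma run_time_mono : Monotone fun k => (run π inp k).time := by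
  refine monotone_nat_of_le_succ fun k => ?_
  have h := run_time_le π inp k
  refine le_min (le_iInf h.1) (le_min (le_iInf fun l => le_iInf fun hl => hl.le) h.2)

lemma run_hist_of_lt {i k : ℕ} (h : i < k) :
    (run π inp k).hist i = (run π inp i).nextObs inp := by
  induction k with
  | zero => omega
  | succ k ih =>
    by_cases hi : i = k
    · subst hi
      exact State.hist_next_self _
    · exact (State.hist_next_of_ne _ hi).trans (ih (by omega))

lemma run_hist_of_le {i k : ℕ} (h : k ≤ i) : (run π inp k).hist i = Obs.blank G := by
  induction k with
  | zero => rfl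
  | succ k ih => exact (State.hist_next_of_ne _ (by omega)).trans (ih (by omega))

/-- Epoch times are nondecreasing, so the infimum is attained at the first state in which the node
holds the packet. -/
lemma deliveryTime_le_iff (l : ℕ) (j : G.Node) (t : ℝ≥0) :
    deliveryTime π inp l j ≤ t ↔ ∃ k, l ∈ (run π inp k).recv j ∧ (run π inp k).time ≤ t := by
  classical
  constructor
  · intro h
    by_cases hex : ∃ k, l ∈ (run π inp k).recv j
    · refine ⟨Nat.find hex, Nat.find_spec hex, le_trans (le_iInf fun k => le_iInf fun hk => ?_) h⟩
      exact run_time_mono π inp (Nat.find_min' hex hk)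
    · push Not at hex
      have : deliveryTime π inp l j = ⊤ := by simp [deliveryTime, hex]
      rw [this] at h
      exact absurd h (by simp)
  · rintro ⟨k, hk, ht⟩
    exact (iInf_le_of_le k (iInf_le _ hk)).trans ht

lemma freshest_eq_histFreshest {k : ℕ} {t : ℝ≥0}
    (ht : (t : ℝ≥0∞) < (run π inp k).nextTime inp) (j : G.Node) :
    freshest π inp j t = histFreshest inp.gen (run π inp k).hist t j := by
  unfold freshest histFreshest
  congr 3
  ext u
  refine exists_congr fun l => and_congr_left fun _ => ?_
  rw [deliveryTime_le_iff]
  constructor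
  · rintro ⟨i, hl, hi⟩
    -- State `i + 1` carries the receptions of observation `i`; state `0` carries none.
    cases i with
    | zero => exact hl.elim
    | succ i =>
      have hik : i < k := by
        by_contra hki
        have h1 := run_time_mono π inp (show k + 1 ≤ i + 1 by omega)
        exact absurd (ht.trans_le (h1.trans hi)) (lt_irrefl _)
      refine ⟨i, ?_⟩
      rw [run_hist_of_lt π inp hik]
      exact ⟨hi, hl⟩
  · rintro ⟨i, hi, hl⟩
    by_cases hik : i < k
    · rw [run_hist_of_lt π inp hik] at hi hl
      exact ⟨i + 1, hl, hi⟩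
    · rw [run_hist_of_le π inp (not_lt.1 hik)] at hl
      exact hl.elim

variable {π inp}

open Classical in
lemma ageScore_run {m : ℕ} {τ : Fin m → ℝ≥0} {U : Set (Fin m × G.Node → ℝ)} {k : ℕ}
    (h : ∀ i, (τ i : ℝ≥0∞) < (run π inp k).nextTime inp) :
    ageScore τ U inp.gen (run π inp k).hist =
      if (fun p => age π inp (τ p.1) p.2) ∈ U then 1 else 0 := by
  have : ∀ p : Fin m × G.Node, age π inp (τ p.1) p.2 =
      (τ p.1 : ℝ) - (histFreshest inp.gen (run π inp k).hist (τ p.1) p.2 : ℝ) := fun p => by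
    rw [age, freshest_eq_histFreshest π inp (h p.1)]
  simp only [ageScore, this]

lemma runValue_run {w : Valuation G R} {K : ℕ}
    (hK : (w.horizon : ℝ≥0∞) < (run π inp K).nextTime inp)
    (hs : ∀ k < K, (run π inp k).nextTime inp ≤ w.horizon ∧ (run π inp k).Sound w.lg π inp k)
    (n k : ℕ) (hk : k ≤ K) (hn : K < k + n) :
    runValue w π inp n k (run π inp k) = w.score inp.gen (run π inp K).hist := by
  induction n generalizing k with
  | zero => omega
  | succ n ih =>
    rw [runValue]
    rcases hk.eq_or_lt with rfl | hlt
    · exact stepValue_of_lt hK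
    · have h := hs k hlt
      rw [stepValue, if_neg (not_lt.2 h.1), if_pos h.2]
      exact ih (k + 1) hlt (by omega)

/-- Finitely many epochs precede the horizon, so for large `n` truncation is harmless; the rules of
the system and, where required, the LGFS rule make every step before the horizon sound. -/
lemma eventually_runValue_eq {w : Valuation G R} (hadm : π.Admissible inp)
    (hlg : w.lg → π.IsPreemptiveLGFS inp) :
    ∃ K, (w.horizon : ℝ≥0∞) < (run π inp K).nextTime inp ∧ ∀ n, K < n →
      runValue w π inp n 0 (State.init G) = w.score inp.gen (run π inp K).hist := by
  classical
  have hex : ∃ K, (w.horizon : ℝ≥0∞) < (run π inp K).nextTime inp := by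
    obtain ⟨k, hk⟩ := hadm.2 w.horizon
    cases k with
    | zero => exact absurd hk not_lt_zero
    | succ k => exact ⟨k, hk⟩
  refine ⟨Nat.find hex, Nat.find_spec hex, fun n hn => ?_⟩
  refine runValue_run (Nat.find_spec hex) (fun k hk => ?_) n 0 (Nat.zero_le _) (by omega)
  have hle := not_lt.1 (Nat.find_min hex hk)
  have hlt := hle.trans_lt ENNReal.coe_lt_top
  refine ⟨hle, fun e => ?_⟩
  have h := hadm.1 k hlt e
  exact ⟨fun l hl => (h.1 l hl).1, h.2.1, fun hw hne => (hlg hw k hlt e).1 hne⟩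

end Run

/-! ### The expected values of the run and of its memoryless version agree -/

section Expectation

variable {G : Network} {Ω : Type*} [MeasurableSpace Ω] {μ : Measure Ω}
  {R : Type*} [MeasurableSpace R] {S : ℕ → Ω → ℝ≥0} {A : ℕ → Ω → ℝ≥0∞} {X : G.Link → ℕ → Ω → ℝ}
  {Z : Ω → R}

lemma map_eq_txLaw (hX : ∀ e k, Measurable (X e k))
    (hX_law : ∀ e k, μ.map (X e k) = expMeasure (G.rate e))
    (hX_indep : iIndepFun (fun (p : G.Link × ℕ) => X p.1 p.2) μ) :
    μ.map (fun ω (p : G.Link × ℕ) => X p.1 p.2 ω) = txLaw G :=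
  (hX_indep.hasLaw_infinitePi (μ := fun p : G.Link × ℕ => expMeasure (G.rate p.1))
    (fun p : G.Link × ℕ => ⟨(hX p.1 p.2).aemeasurable, hX_law p.1 p.2⟩)
    (measurable_pi_lambda _ fun p : G.Link × ℕ => hX p.1 p.2).aemeasurable).map_eq

variable [IsProbabilityMeasure μ]

/-- By independence, the durations can be integrated out with generation times, arrivals and seed
fixed, which reduces the claim to `lintegral_runValue`. The zero durations on the right are
placeholders: `freshValue` overwrites all finish times before they are read. -/
theorem lintegral_runValue_eq {w : Valuation G R} {π : Policy G R}
    (hw : Measurable fun z : (ℕ → ℝ≥0) × (ℕ → Obs G) => w.score z.1 z.2)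
    (hS : ∀ l, Measurable (S l)) (hA : ∀ l, Measurable (A l))
    (hX : ∀ e k, Measurable (X e k)) (hZ : Measurable Z)
    (hX_law : ∀ e k, μ.map (X e k) = expMeasure (G.rate e))
    (hX_indep : iIndepFun (fun (p : G.Link × ℕ) => X p.1 p.2) μ)
    (hX_ext : IndepFun (fun ω (p : G.Link × ℕ) => X p.1 p.2 ω)
      (fun ω => ((fun l => S l ω), (fun l => A l ω), Z ω)) μ) (n : ℕ) :
    ∫⁻ ω, runValue w π ⟨fun l => S l ω, fun l => A l ω, fun e k => X e k ω, Z ω⟩ n 0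
        (State.init G) ∂μ =
      ∫⁻ ω, freshValue w π ⟨fun l => S l ω, fun l => A l ω, fun _ _ => 0, Z ω⟩ n 0
        (State.init G) 0 ∂μ := by
  set E := (ℕ → ℝ≥0) × (ℕ → ℝ≥0∞) × R with hE
  have hmX : Measurable fun ω (p : G.Link × ℕ) => X p.1 p.2 ω :=
    measurable_pi_lambda _ fun p => hX p.1 p.2
  have hmE : Measurable fun ω => (((fun l => S l ω), (fun l => A l ω), Z ω) : E) :=
    (measurable_pi_lambda _ hS).prodMk ((measurable_pi_lambda _ hA).prodMk hZ)
  let F : (G.Link × ℕ → ℝ) × E → Input G R := fun z =>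
    ⟨z.2.1, z.2.2.1, fun e k => z.1 (e, k), z.2.2.2⟩
  have hF : Measurable F := by
    refine measurable_input_iff.2 ⟨?_, ?_, ?_, ?_⟩
    · exact measurable_snd.fst
    · exact measurable_snd.snd.fst
    · exact measurable_pi_lambda _ fun e => measurable_pi_lambda _ fun k =>
        (measurable_pi_apply (e, k)).comp measurable_fst
    · exact measurable_snd.snd.snd
  have hV : Measurable fun z => runValue w π (F z) n 0 (State.init G) :=
    measurable_runValue hw measurable_const hF n 0
  have hF0 : Measurable fun z : E => freshValue w π (F (0, z)) n 0 (State.init G) 0 :=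
    measurable_freshValue hw measurable_const (hF.comp (by fun_prop)) measurable_const n 0
  have hlaw := (indepFun_iff_map_prod_eq_prod_map_map hmX.aemeasurable hmE.aemeasurable).1 hX_ext
  rw [map_eq_txLaw hX hX_law hX_indep] at hlaw
  have hprob : IsProbabilityMeasure
      (μ.map fun ω => (((fun l => S l ω), (fun l => A l ω), Z ω) : E)) :=
    Measure.isProbabilityMeasure_map hmE.aemeasurable
  have h1 := lintegral_map (μ := μ) hV (hmX.prodMk hmE)
  have h2 := lintegral_map (μ := μ) hF0 hmE
  refine h1.symm.trans (Eq.trans ?_ h2)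
  rw [hlaw, lintegral_prod_symm _ hV.aemeasurable]
  refine lintegral_congr fun z => ?_
  rw [← lintegral_runValue hw (F (0, z)) n 0 (State.init G) 0 zero_le]
  -- All links are idle at the start, so the initial clock vector has no effect.
  have : ∀ r : G.Link → ℝ≥0∞, (State.init G).withClock 0 r = State.init G := fun r => rfl
  simp only [this, lintegral_const, measure_univ, mul_one]
  rfl

open Classical in
-- Dominated convergence with bound 1: almost surely the truncated values are eventually constant
-- and equal to the indicator of the event.
lemma tendsto_lintegral_runValue {w : Valuation G R} {π : Policy G R} {m : ℕ}
    {τ : Fin m → ℝ≥0} {U : Set (Fin m × G.Node → ℝ)} (hU : MeasurableSet U)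
    (hscore : w.score = ageScore τ U) (hτ : ∀ i, τ i ≤ w.horizon) (ho : w.other ≤ 1)
    {inp : Ω → Input G R} (hinp : Measurable inp) (hadm : ∀ᵐ ω ∂μ, π.Admissible (inp ω))
    (hlg : w.lg → ∀ᵐ ω ∂μ, π.IsPreemptiveLGFS (inp ω)) :
    Filter.Tendsto (fun n => ∫⁻ ω, runValue w π (inp ω) n 0 (State.init G) ∂μ) Filter.atTop
      (nhds (μ {ω | (fun p => age π (inp ω) (τ p.1) p.2) ∈ U})) := by
  have hw : Measurable fun z : (ℕ → ℝ≥0) × (ℕ → Obs G) => w.score z.1 z.2 := by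
    rw [hscore]; exact measurable_ageScore hU
  have hset : MeasurableSet {ω | (fun p : Fin m × G.Node => age π (inp ω) (τ p.1) p.2) ∈ U} :=
    hU.preimage (measurable_pi_lambda _ fun p =>
      (measurable_pi_apply p.2).comp (measurable_age π hinp (τ p.1)))
  rw [← lintegral_indicator_one hset]
  refine tendsto_lintegral_of_dominated_convergence (fun _ => 1)
    (fun n => measurable_runValue hw measurable_const hinp n 0) (fun n => ?_) (by simp) ?_
  · refine Filter.Eventually.of_forall fun ω => ?_
    have hle : ∀ k x, runValue w π (inp ω) n k x ≤ 1 := by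
      induction n with
      | zero => exact fun _ _ => ho
      | succ n ih =>
        intro k x
        rw [runValue, stepValue, hscore]
        split_ifs
        · exact ageScore_le_one _ _
        · exact ih _ _
        · exact ho
    exact hle _ _
  · have hlg' : ∀ᵐ ω ∂μ, w.lg → π.IsPreemptiveLGFS (inp ω) := by
      by_cases h : w.lg
      · filter_upwards [hlg h] with ω hω _ using hω
      · exact Filter.Eventually.of_forall fun ω h' => absurd h' h
    filter_upwards [hadm, hlg'] with ω h1 h2
    obtain ⟨K, hK, hn⟩ := eventually_runValue_eq (w := w) h1 h2
    refine tendsto_const_nhds.congr' ?_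
    filter_upwards [Filter.eventually_gt_atTop K] with n hKn
    rw [hn n hKn, hscore, ageScore_run fun i => lt_of_le_of_lt (by exact_mod_cast hτ i) hK]
    rfl

end Expectation

end AoI

/-! ### The stochastic order of the age processes -/

theorem mainTheorem2 (G : AoI.Network) {Ω : Type*} [MeasurableSpace Ω] (μ : Measure Ω)
    [IsProbabilityMeasure μ] {R : Type*} [MeasurableSpace R]
    -- generation times, arrival times at the gateway, transmission times, seed of the policies
    (S : ℕ → Ω → ℝ≥0) (A : ℕ → Ω → ℝ≥0∞) (X : G.Link → ℕ → Ω → ℝ) (Z : Ω → R)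
    (hS : ∀ l, Measurable (S l)) (hA : ∀ l, Measurable (A l))
    (hX : ∀ e k, Measurable (X e k)) (hZ : Measurable Z)
    (hS_mono : ∀ᵐ ω ∂μ, Monotone fun l => S l ω)
    (hSA : ∀ᵐ ω ∂μ, ∀ l, (S l ω : ℝ≥0∞) ≤ A l ω)
    (hA_fin : ∀ᵐ ω ∂μ, ∀ t : ℝ≥0, {l | A l ω ≤ t}.Finite)
    -- the transmission times are exponential, independent across the links, i.i.d. across time,
    -- and independent of the generation and arrival processes
    (hX_law : ∀ e k, μ.map (X e k) = expMeasure (G.rate e))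
    (hX_indep : iIndepFun (fun (p : G.Link × ℕ) => X p.1 p.2) μ)
    (hX_ext : IndepFun (fun ω (p : G.Link × ℕ) => X p.1 p.2 ω)
      (fun ω => ((fun l => S l ω), (fun l => A l ω), Z ω)) μ)
    (P π : AoI.Policy G R)
    (hP : ∀ᵐ ω ∂μ, P.Admissible
      ⟨fun l => S l ω, fun l => A l ω, fun e k => X e k ω, Z ω⟩)
    (hP_LGFS : ∀ᵐ ω ∂μ, P.IsPreemptiveLGFS
      ⟨fun l => S l ω, fun l => A l ω, fun e k => X e k ω, Z ω⟩)
    (hπ : ∀ᵐ ω ∂μ, π.Admissible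
      ⟨fun l => S l ω, fun l => A l ω, fun e k => X e k ω, Z ω⟩) :
    (∀ t, Measurable fun ω => AoI.age P
      ⟨fun l => S l ω, fun l => A l ω, fun e k => X e k ω, Z ω⟩ t) ∧
    (∀ t, Measurable fun ω => AoI.age π
      ⟨fun l => S l ω, fun l => A l ω, fun e k => X e k ω, Z ω⟩ t) ∧
    AoI.ProcessStochLE μ μ
      (fun t ω => AoI.age P ⟨fun l => S l ω, fun l => A l ω, fun e k => X e k ω, Z ω⟩ t)
      (fun t ω => AoI.age π ⟨fun l => S l ω, fun l => A l ω, fun e k => X e k ω, Z ω⟩ t) := by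
  have hinp : Measurable fun ω => (⟨fun l => S l ω, fun l => A l ω, fun e k => X e k ω, Z ω⟩ :
      AoI.Input G R) :=
    AoI.measurable_input_iff.2 ⟨measurable_pi_lambda _ hS, measurable_pi_lambda _ hA,
      measurable_pi_lambda _ fun e => measurable_pi_lambda _ fun k => hX e k, hZ⟩
  refine ⟨fun t => AoI.measurable_age P hinp t, fun t => AoI.measurable_age π hinp t, ?_⟩
  intro m τ _ U hUp hU
  have hτ : ∀ i, τ i ≤ Finset.univ.sup τ := fun i => Finset.le_sup (Finset.mem_univ i)
  -- The horizon is the latest observation time. Failed or truncated runs are worth 0 for `P` and 1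
  -- for `π`, so that truncation favours the inequality on both sides.
  let w : AoI.Valuation G R := ⟨Finset.univ.sup τ, AoI.ageScore τ U, 0, True⟩
  let v : AoI.Valuation G R := ⟨Finset.univ.sup τ, AoI.ageScore τ U, 1, False⟩
  have hmeas := AoI.measurable_ageScore (τ := τ) hU
  have h1 := AoI.tendsto_lintegral_runValue (w := w) hU rfl hτ zero_le_one hinp hP fun _ => hP_LGFS
  have h2 := AoI.tendsto_lintegral_runValue (w := v) hU rfl hτ le_rfl hinp hπ fun h => h.elim
  refine le_of_tendsto_of_tendsto' h1 h2 fun n => ?_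
  rw [AoI.lintegral_runValue_eq (w := w) hmeas hS hA hX hZ hX_law hX_indep hX_ext,
    AoI.lintegral_runValue_eq (w := v) hmeas hS hA hX hZ hX_law hX_indep hX_ext]
  -- With the durations integrated out, the comparison is made for each fixed realization of
  -- generation times, arrivals and seed, which gives the unconditional order.
  refine lintegral_mono_ae ?_
  filter_upwards [hSA] with ω hω
  exact AoI.freshValue_le_freshValue (w := w) (v := v) hmeas hmeas rfl rfl trivial rfl
    (fun s h => AoI.ageScore_le_one s h)
    (fun x y hx hd => AoI.ageScore_le_ageScore hUp hω hx hd) (n + n) n n le_rfl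
    AoI.consistent_init AoI.consistent_init (fun e => Or.inl fun l hl => hl.elim)
    ⟨fun j l hl => hl.elim, fun i j l hl => hl.elim⟩
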